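/- Let $\mu>0$ and $\alpha\in(0,1)$. A closed curve is a map $c:\mathbb{R}/\mathbb{Z}\to\mathbb{R}^2$; for a regular curve ($\partial_x c\neq 0$) write $\partial_s=|\partial_x c|^{-1}\partial_x$, $ds=|\partial_x c|\,dx$, $\tau=\partial_s c$, let $\nu$ be the counterclockwise rotation of $\tau$ by $\pi/2$, let $k=\langle\partial_s^2 c,\nu\rangle$ be the oriented curvature, and let $$\mathcal{E}_\mu(c)=\int_c k^2\,ds+\mu\,\ell(c),$$ where $\ell(c)$ is the length of $c$. An elastica is a smooth regular closed curve $c$ that is a critical point of $\mathcal{E}_\mu$, i.e. $\frac{d}{d\varepsilon}\big|_{\varepsilon=0}\mathcal{E}_\mu(c+\varepsilon\psi)=0$ for every $\psi\in C^2(\mathbb{R}/\mathbb{Z};\mathbb{R}^2)$. Let $\gamma:[0,\infty)\times\mathbb{R}/\mathbb{Z}\to\mathbb{R}^2$, $\gamma_t=\gamma(t,\cdot)$, be a global solution of the elastic flow of closed curves with initial datum $\gamma_0$: $\gamma$ belongs to the parabolic Hölder space $C^{\frac{4+\alpha}{4},4+\alpha}([0,T]\times\mathbb{R}/\mathbb{Z})$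 for every $T>0$, is $C^\infty$ on $(0,\infty)\times\mathbb{R}/\mathbb{Z}$, every $\gamma_t$ is regular, $\gamma(0,\cdot)=\gamma_0$, and for all $t\ge 0$ $$\partial_t\gamma-\langle\partial_t\gamma,\tau\rangle\tau=\left(-2\partial_s^2k-k^3+\mu k\right)\nu .$$ Then there exist an increasing sequence of times $t_i\to\infty$ with $t_i>0$, smooth orientation-preserving diffeomorphisms $\varphi_i$ of $\mathbb{R}/\mathbb{Z}$, points $p_i\in\mathbb{R}^2$ and an elastica $\gamma_\infty$ such that $\gamma_{t_i}\circ\varphi_i-p_i\to\gamma_\infty$ smoothly as $i\to\infty$, that is, in $C^m(\mathbb{R}/\mathbb{Z};\mathbb{R}^2)$ for every $m\in\mathbb{N}$. -/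

import Mathlib

open scoped ContDiff

noncomputable section

namespace ElasticFlow

/-- The Euclidean plane. -/
abbrev Plane : Type := EuclideanSpace ℝ (Fin 2)

/-! ### Geometry of a regular plane curve

A closed curve is parametrized by the unit circle `ℝ / ℤ`, that is, by a 1-periodic map
`c : ℝ → Plane`. All notions below are the usual ones where `deriv c` does not vanish. -/

/-- The derivative `∂ₛ f = |c'|⁻¹ f'` of `f` with respect to the arclength of `c`. -/
def arcDeriv {F : Type*} [NormedAddCommGroup F] [NormedSpace ℝ F]
    (c : ℝ → Plane) (f : ℝ → F) (x : ℝ) : F :=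
  ‖deriv c x‖⁻¹ • deriv f x

/-- The unit tangent vector `τ = ∂ₛ c`. -/
def tangent (c : ℝ → Plane) : ℝ → Plane := arcDeriv c c

/-- The unit normal vector `ν`: the counterclockwise rotation of `τ` by `π / 2`. -/
def normal (c : ℝ → Plane) (x : ℝ) : Plane := !₂[-(tangent c x 1), tangent c x 0]

/-- The oriented curvature `k = ⟨∂ₛ² c, ν⟩`. -/
def curvature (c : ℝ → Plane) (x : ℝ) : ℝ :=
  inner ℝ (arcDeriv c (tangent c) x) (normal c x)

/-- The elastic energy `∫ k² ds + μ ℓ(c)` of a closed curve, with `ds = |c'| dx`. -/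
def elasticEnergy (μ : ℝ) (c : ℝ → Plane) : ℝ :=
  (∫ x in (0 : ℝ)..1, curvature c x ^ 2 * ‖deriv c x‖) + μ * ∫ x in (0 : ℝ)..1, ‖deriv c x‖

/-- `c` is an elastica: a smooth regular closed curve at which the first variation of the elastic
energy, taken among closed curves, vanishes in every direction `ψ`. -/
structure IsElastica (μ : ℝ) (c : ℝ → Plane) : Prop where
  smooth : ContDiff ℝ ∞ c
  periodic : Function.Periodic c 1
  regular : ∀ x, deriv c x ≠ 0
  critical : ∀ ψ : ℝ → Plane, ContDiff ℝ 2 ψ → Function.Periodic ψ 1 →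
    HasDerivAt (fun ε : ℝ => elasticEnergy μ (fun x => c x + ε • ψ x)) 0 0

/-! ### The elastic flow -/

/-- The time derivative on `[0, ∞)`, one-sided at `t = 0`. -/
def timeDeriv (γ : ℝ → ℝ → Plane) (t x : ℝ) : Plane :=
  derivWithin (fun r => γ r x) (Set.Ici 0) t

/-- `γ` (1-periodic in space) lies in the parabolic Hölder space
`C^{(4 + α) / 4, 4 + α}([0, T] × [0, 1])` for every `T > 0`: the derivatives `∂ₓʲ γ`, `j ≤ 4`, and
`∂ₜ γ` exist and are continuous up to `t = 0`, and the Hölder seminorms that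
enter the norm of this space are finite. -/
structure IsParabolicHolder (α : ℝ) (γ : ℝ → ℝ → Plane) : Prop where
  contDiff_space : ∀ t, 0 ≤ t → ContDiff ℝ 4 (γ t)
  differentiable_time : ∀ t, 0 ≤ t → ∀ x,
    DifferentiableWithinAt ℝ (fun r => γ r x) (Set.Ici 0) t
  continuous_space : ∀ j : ℕ, j ≤ 4 →
    ContinuousOn (fun p : ℝ × ℝ => iteratedDeriv j (γ p.1) p.2) (Set.Ici 0 ×ˢ Set.univ)
  continuous_time :
    ContinuousOn (fun p : ℝ × ℝ => timeDeriv γ p.1 p.2) (Set.Ici 0 ×ˢ Set.univ)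
  holder_space : ∀ T : ℝ, 0 < T → ∃ C : ℝ, ∀ t ∈ Set.Icc 0 T,
    ∀ x ∈ Set.Icc (0 : ℝ) 1, ∀ y ∈ Set.Icc (0 : ℝ) 1,
      ‖iteratedDeriv 4 (γ t) x - iteratedDeriv 4 (γ t) y‖ ≤ C * |x - y| ^ α ∧
      ‖timeDeriv γ t x - timeDeriv γ t y‖ ≤ C * |x - y| ^ α
  holder_time : ∀ T : ℝ, 0 < T → ∃ C : ℝ, ∀ t ∈ Set.Icc 0 T, ∀ r ∈ Set.Icc 0 T,
    ∀ x ∈ Set.Icc (0 : ℝ) 1,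
      (∀ j : ℕ, 1 ≤ j → j ≤ 4 →
        ‖iteratedDeriv j (γ t) x - iteratedDeriv j (γ r) x‖
          ≤ C * |t - r| ^ ((4 + α - j) / 4)) ∧
      ‖timeDeriv γ t x - timeDeriv γ r x‖ ≤ C * |t - r| ^ (α / 4)

/-- `γ t x`, `t ≥ 0`, is a solution in `[0, ∞)` of the elastic flow of closed curves with initial
datum `γ₀`: a time-dependent family of regular closed curves of class `C^{(4 + α) / 4, 4 + α}` up to
`t = 0` and smooth for positive times, whose normal velocity is `-2 ∂ₛ² k - k³ + μ k`. The
tangential velocity is arbitrary. -/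
structure IsGlobalSolution (μ α : ℝ) (γ₀ : ℝ → Plane) (γ : ℝ → ℝ → Plane) : Prop where
  initial : γ 0 = γ₀
  closed : ∀ t, 0 ≤ t → Function.Periodic (γ t) 1
  regular : ∀ t, 0 ≤ t → ∀ x, deriv (γ t) x ≠ 0
  holder : IsParabolicHolder α γ
  smooth : ContDiffOn ℝ ∞ (fun p : ℝ × ℝ => γ p.1 p.2) (Set.Ioi 0 ×ˢ Set.univ)
  motion : ∀ t, 0 ≤ t → ∀ x,
    timeDeriv γ t x - inner ℝ (timeDeriv γ t x) (tangent (γ t) x) • tangent (γ t) x =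
      (-2 * arcDeriv (γ t) (arcDeriv (γ t) (curvature (γ t))) x
        - curvature (γ t) x ^ 3 + μ * curvature (γ t) x) • normal (γ t) x

/-- A smooth orientation preserving diffeomorphism of the circle `ℝ / ℤ`, lifted to `ℝ`. -/
structure IsReparametrization (φ : ℝ → ℝ) : Prop where
  smooth : ContDiff ℝ ∞ φ
  deriv_pos : ∀ x, 0 < deriv φ x
  map_add_one : ∀ x, φ (x + 1) = φ x + 1

/-- Smooth convergence of a sequence of closed curves: uniform convergence of the derivatives of
every order. -/
def SmoothlyConverges (c : ℕ → ℝ → Plane) (cLim : ℝ → Plane) : Prop :=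
  ∀ m : ℕ, TendstoUniformly (fun i => iteratedDeriv m (c i)) (iteratedDeriv m cLim) Filter.atTop

end ElasticFlow

end

/-! Write `V = -2 ∂ₛ²k - k³ + μk` for the normal velocity and `k_j = ∂ₛʲ k`. The flow is the `L²`
gradient flow of the energy `E`: `dE/dt = -∫ V² ds` (`hasDerivAt_energyAt`). So for `t ≥ 1` both `∫
k² ds` and, since `μ > 0`, the length are bounded above; as a closed curve has `∫ |k| ds ≥ 1`,
Cauchy–Schwarz bounds the length below (`exists_basic_bounds`).

Higher derivatives are controlled by `d/dt ∫ k_j² = -4 ∫ k_{j+2}² + (lower order)`. The lower order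
terms are integrals of `k_j` times differential polynomials in `k`, and interpolation between the
`L²` norms of `k` and `k_{j+2}` bounds them by a power of `‖k_{j+2}‖` strictly below 2. They are
absorbed, and Gronwall bounds every `k_j` for `t ≥ 1` (`exists_wNorm_le`, `exists_abs_jetAt_le`).
The arbitrary tangential velocity plays no role: it is removed from the time derivative (`dN`) and
enters integrals only through a total derivative.

Since `E ≥ 0`, there are arbitrarily late times at which `‖V‖` is small in `L²`, hence uniformly,
because `∂ₛV` is bounded (`exists_time_vel_le`). At these times the curves, parametrized with
constant speed and translated to a base point, have all derivatives bounded, so Arzelà–Ascoli gives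
a smooth limit (`exists_smooth_limit`).

The limit is recognized through a conservation law. The vector `F = (μ - k²) τ - 2 (∂ₛk) ν`
satisfies `∂ₛF = V ν` (`frameD_forcePoly`), so its oscillation tends to zero along the sequence and
it is constant on the limit curve. Constancy of `F` makes the first variation the integral of a
total derivative, which vanishes on closed curves (`isElastica_of_const`). -/

noncomputable section

namespace ElasticFlow

/-! ### Weighted integrals over one period -/

/-- The integral of `f` over one period with respect to `v dx`. -/
def wInt (v f : ℝ → ℝ) : ℝ := ∫ x in (0 : ℝ)..1, f x * v x

/-- The `L²` norm over one period with respect to `v dx`. -/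
def wNorm (v f : ℝ → ℝ) : ℝ := √(wInt v fun x => f x ^ 2)

section Weighted

variable {v f g : ℝ → ℝ}

lemma wInt_add (hv : Continuous v) (hf : Continuous f) (hg : Continuous g) :
    wInt v (fun x => f x + g x) = wInt v f + wInt v g := by
  simp only [wInt, add_mul]
  exact intervalIntegral.integral_add ((hf.mul hv).intervalIntegrable _ _)
    ((hg.mul hv).intervalIntegrable _ _)

lemma wInt_const_mul (c : ℝ) : wInt v (fun x => c * f x) = c * wInt v f := by
  unfold wInt
  rw [← intervalIntegral.integral_const_mul]
  congr 1; ext x; ring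

lemma wInt_const (c : ℝ) : wInt v (fun _ => c) = c * wInt v fun _ => 1 := by
  rw [← wInt_const_mul]
  simp only [mul_one]

lemma wInt_mono (hv : Continuous v) (hpos : ∀ x, 0 < v x) (hf : Continuous f) (hg : Continuous g)
    (h : ∀ x, f x ≤ g x) : wInt v f ≤ wInt v g :=
  intervalIntegral.integral_mono_on zero_le_one ((hf.mul hv).intervalIntegrable _ _)
    ((hg.mul hv).intervalIntegrable _ _)
    fun x _ => mul_le_mul_of_nonneg_right (h x) (hpos x).le

lemma wInt_nonneg (hpos : ∀ x, 0 < v x) (h : ∀ x, 0 ≤ f x) : 0 ≤ wInt v f :=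
  intervalIntegral.integral_nonneg zero_le_one fun x _ => mul_nonneg (h x) (hpos x).le

lemma wNorm_nonneg : 0 ≤ wNorm v f := Real.sqrt_nonneg _

lemma wNorm_sq (hpos : ∀ x, 0 < v x) : wNorm v f ^ 2 = wInt v fun x => f x ^ 2 :=
  Real.sq_sqrt (wInt_nonneg hpos fun _ => sq_nonneg _)

/-- Cauchy–Schwarz, from the discriminant of the nonnegative quadratic `s ↦ ∫ (s f + g)² v`. -/
lemma wInt_mul_le (hv : Continuous v) (hpos : ∀ x, 0 < v x) (hf : Continuous f)
    (hg : Continuous g) : wInt v (fun x => f x * g x) ≤ wNorm v f * wNorm v g := by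
  have key : ∀ s : ℝ, 0 ≤ wInt v (fun x => f x ^ 2) * (s * s)
      + 2 * wInt v (fun x => f x * g x) * s + wInt v (fun x => g x ^ 2) := by
    intro s
    have h0 : 0 ≤ wInt v fun x => (s * f x + g x) ^ 2 := wInt_nonneg hpos fun x => sq_nonneg _
    have h1 : (fun x => (s * f x + g x) ^ 2)
        = fun x => ((s * s) * f x ^ 2 + (2 * s) * (f x * g x)) + g x ^ 2 := by
      ext x; ring
    rw [h1, wInt_add hv (by fun_prop) (by fun_prop), wInt_add hv (by fun_prop) (by fun_prop),
      wInt_const_mul, wInt_const_mul] at h0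
    linarith
  have h := discrim_le_zero key
  rw [discrim, ← wNorm_sq hpos, ← wNorm_sq hpos] at h
  refine (le_abs_self _).trans (abs_le_of_sq_le_sq ?_ (mul_nonneg wNorm_nonneg wNorm_nonneg))
  nlinarith

lemma wNorm_abs : wNorm v (fun x => |f x|) = wNorm v f := by
  simp [wNorm]

lemma wInt_abs_mul_le (hv : Continuous v) (hpos : ∀ x, 0 < v x) (hf : Continuous f)
    (hg : Continuous g) : wInt v (fun x => |f x * g x|) ≤ wNorm v f * wNorm v g := by
  have := wInt_mul_le hv hpos hf.abs hg.abs
  simpa only [abs_mul, wNorm_abs] using this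

lemma abs_wInt_le (hv : Continuous v) (hpos : ∀ x, 0 < v x) (hf : Continuous f) :
    |wInt v f| ≤ wInt v fun x => |f x| := by
  rw [abs_le]
  constructor
  · have : wInt v (fun x => (-1) * |f x|) ≤ wInt v f :=
      wInt_mono hv hpos (by fun_prop) hf fun x => by linarith [neg_abs_le (f x)]
    rw [wInt_const_mul] at this
    linarith
  · exact wInt_mono hv hpos hf hf.abs fun x => le_abs_self _

lemma wNorm_mul_le (hv : Continuous v) (hpos : ∀ x, 0 < v x) (hf : Continuous f)
    (hg : Continuous g) {S : ℝ} (hS : ∀ x, |f x| ≤ S) :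
    wNorm v (fun x => f x * g x) ≤ S * wNorm v g := by
  have hS0 : 0 ≤ S := (abs_nonneg _).trans (hS 0)
  refine (le_abs_self _).trans (abs_le_of_sq_le_sq ?_ (mul_nonneg hS0 wNorm_nonneg))
  rw [mul_pow, wNorm_sq hpos, wNorm_sq hpos, ← wInt_const_mul]
  refine wInt_mono hv hpos (by fun_prop) (by fun_prop) fun x => ?_
  rw [mul_pow]
  exact mul_le_mul_of_nonneg_right (sq_le_sq' (by linarith [neg_abs_le (f x), hS x])
    ((le_abs_self _).trans (hS x))) (sq_nonneg _)

lemma wNorm_le_of_abs_le (hv : Continuous v) (hpos : ∀ x, 0 < v x) (hf : Continuous f) {S : ℝ}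
    (hS : ∀ x, |f x| ≤ S) : wNorm v f ^ 2 ≤ S ^ 2 * wInt v (fun _ => 1) := by
  rw [wNorm_sq hpos, ← wInt_const_mul]
  refine wInt_mono hv hpos (by fun_prop) (by fun_prop) fun x => ?_
  nlinarith [sq_abs (f x), abs_nonneg (f x), hS x]

/-- Here `g` is the arclength derivative of the periodic function `f`. Every integration by parts
below reduces to this. -/
lemma wInt_deriv_eq_zero (hv : Continuous v) (hg : Continuous g)
    (hd : ∀ x, HasDerivAt f (v x * g x) x) (hp : Function.Periodic f 1) : wInt v g = 0 := by
  have : wInt v g = ∫ x in (0 : ℝ)..1, v x * g x := by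
    unfold wInt; congr 1; ext x; ring
  rw [this, intervalIntegral.integral_eq_sub_of_hasDerivAt (fun x _ => hd x)
    ((hv.mul hg).intervalIntegrable _ _)]
  have h1 : f 1 = f 0 := by simpa using hp 0
  rw [h1, sub_self]

lemma exists_mem_Icc_of_periodic (hf : Function.Periodic f 1) (x : ℝ) :
    ∃ y ∈ Set.Icc (0 : ℝ) 1, f y = f x :=
  ⟨Int.fract x, ⟨Int.fract_nonneg x, (Int.fract_lt_one x).le⟩, by
    have := hf.sub_int_mul_eq ⌊x⌋ (x := x)
    rwa [mul_one] at this⟩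

lemma norm_integral_le_integral_zero_one {E : Type*} [NormedAddCommGroup E] [NormedSpace ℝ E]
    {h : ℝ → E} (hh : Continuous h) {x y : ℝ} (hx : x ∈ Set.Icc (0 : ℝ) 1)
    (hy : y ∈ Set.Icc (0 : ℝ) 1) : ‖∫ z in x..y, h z‖ ≤ ∫ z in (0 : ℝ)..1, ‖h z‖ := by
  refine intervalIntegral.norm_integral_le_abs_integral_norm.trans
    ((intervalIntegral.abs_integral_mono_interval (c := 0) (d := 1) ?_
      (Filter.Eventually.of_forall fun _ => norm_nonneg _)
      (hh.norm.intervalIntegrable _ _)).trans_eq ?_)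
  · rw [Set.uIoc_of_le zero_le_one, Set.uIoc]
    exact Set.Ioc_subset_Ioc (le_min hx.1 hy.1) (max_le hx.2 hy.2)
  · exact abs_of_nonneg (intervalIntegral.integral_nonneg zero_le_one fun _ _ => norm_nonneg _)

/-- A one-dimensional Sobolev inequality. -/
lemma sq_mul_length_le (hv : Continuous v) (hpos : ∀ x, 0 < v x) (hg : Continuous g)
    (hd : ∀ x, HasDerivAt f (v x * g x) x) (hp : Function.Periodic f 1) (x : ℝ) :
    f x ^ 2 * wInt v (fun _ => 1)
      ≤ wNorm v f ^ 2 + 2 * wInt v (fun _ => 1) * (wNorm v f * wNorm v g) := by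
  have hf : Continuous f := continuous_iff_continuousAt.2 fun x => (hd x).continuousAt
  obtain ⟨x', hx', hxx'⟩ := exists_mem_Icc_of_periodic hp x
  rw [← hxx']
  set A := wInt v fun x => |f x * g x| with hA
  have hfg : A ≤ wNorm v f * wNorm v g := wInt_abs_mul_le hv hpos hf hg
  have hL : 0 ≤ wInt v (fun _ => 1) := wInt_nonneg hpos fun _ => zero_le_one
  -- The difference of squares is `2 ∫ f g v` between `y` and `x'`.
  have h1 : ∀ y ∈ Set.Icc (0 : ℝ) 1, f x' ^ 2 - f y ^ 2 ≤ 2 * A := by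
    intro y hy
    have hder : ∀ z, HasDerivAt (fun z => f z ^ 2) (2 * ((f z * g z) * v z)) z := fun z => by
      have := (hd z).pow 2
      refine this.congr_deriv ?_
      push_cast; ring
    have hint := intervalIntegral.integral_eq_sub_of_hasDerivAt (a := y) (b := x')
      (fun z _ => hder z) (Continuous.intervalIntegrable (by fun_prop) _ _)
    rw [← hint, intervalIntegral.integral_const_mul]
    refine mul_le_mul_of_nonneg_left ?_ zero_le_two
    refine (le_abs_self _).trans ((norm_integral_le_integral_zero_one
      (h := fun z => f z * g z * v z) (by fun_prop) hy hx').trans_eq ?_)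
    simp only [hA, wInt, Real.norm_eq_abs, abs_mul, abs_of_pos (hpos _)]
  -- Averaging over `y` against `v dy` replaces `f y ^ 2` by the squared `L²` norm.
  have h2 : wInt v (fun _ => f x' ^ 2) ≤ wInt v (fun y => f y ^ 2 + 2 * A) :=
    intervalIntegral.integral_mono_on zero_le_one (Continuous.intervalIntegrable (by fun_prop) _ _)
      (Continuous.intervalIntegrable (by fun_prop) _ _)
      fun y hy => mul_le_mul_of_nonneg_right (by linarith [h1 y hy]) (hpos y).le
  rw [wInt_add hv (by fun_prop) (by fun_prop), wInt_const, wInt_const (2 * A),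
    ← wNorm_sq hpos] at h2
  nlinarith

end Weighted

/-! ### Interpolation between arclength derivatives -/

/-- `f` is a sequence of periodic functions, each the arclength derivative of the previous one,
for the length element `v dx`. -/
structure IsJet (v : ℝ → ℝ) (f : ℕ → ℝ → ℝ) : Prop where
  cont : Continuous v
  pos : ∀ x, 0 < v x
  hasDerivAt : ∀ j x, HasDerivAt (f j) (v x * f (j + 1) x) x
  periodic : ∀ j, Function.Periodic (f j) 1

/-- The product of the derivatives of the orders listed in `l`. -/
def jetProd (f : ℕ → ℝ → ℝ) (l : List ℕ) (x : ℝ) : ℝ := (l.map fun a => f a x).prod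

section Interpolation

variable {v : ℝ → ℝ} {f : ℕ → ℝ → ℝ}

lemma IsJet.continuous (h : IsJet v f) (j : ℕ) : Continuous (f j) :=
  continuous_iff_continuousAt.2 fun x => (h.hasDerivAt j x).continuousAt

lemma IsJet.continuous_jetProd (h : IsJet v f) (l : List ℕ) : Continuous (jetProd f l) := by
  induction l with
  | nil => exact continuous_const
  | cons a l ih =>
    have : jetProd f (a :: l) = fun x => f a x * jetProd f l x := by
      ext x; simp [jetProd]
    rw [this]
    exact (h.continuous a).mul ih

lemma IsJet.wInt_mul_succ (h : IsJet v f) (i j : ℕ) :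
    wInt v (fun x => f (i + 1) x * f j x) = - wInt v (fun x => f i x * f (j + 1) x) := by
  have hc := h.continuous
  have h0 : wInt v (fun x => f (i + 1) x * f j x + f i x * f (j + 1) x) = 0 := by
    refine wInt_deriv_eq_zero (f := fun x => f i x * f j x) h.cont (by fun_prop) (fun x => ?_)
      ((h.periodic i).mul (h.periodic j))
    refine ((h.hasDerivAt i x).mul (h.hasDerivAt j x)).congr_deriv ?_
    ring
  rw [wInt_add h.cont (by fun_prop) (by fun_prop)] at h0
  linarith

/-- Integration by parts followed by Cauchy–Schwarz. It says that the `L²` norms of successive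
derivatives form a log-convex sequence. -/
lemma IsJet.wNorm_sq_le (h : IsJet v f) (j : ℕ) :
    wNorm v (f (j + 1)) ^ 2 ≤ wNorm v (f j) * wNorm v (f (j + 2)) := by
  have h1 := h.wInt_mul_succ j (j + 1)
  have h2 : wNorm v (f (j + 1)) ^ 2 = wInt v fun x => f (j + 1) x * f (j + 1) x := by
    rw [wNorm_sq h.pos]; simp only [pow_two]
  rw [h2, h1]
  refine (neg_le_abs _).trans ((abs_wInt_le h.cont h.pos
    ((h.continuous j).mul (h.continuous _))).trans ?_)
  exact wInt_abs_mul_le h.cont h.pos (h.continuous _) (h.continuous _)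

/-- Discrete convexity: a log-convex sequence lies below a geometric sequence if it does so at both
ends. -/
lemma le_geometric_of_log_convex {u : ℕ → ℝ} (hu : ∀ j, 0 ≤ u j)
    (hc : ∀ j, u (j + 1) ^ 2 ≤ u j * u (j + 2)) {K Y : ℝ} (hK : 0 < K) (hY : 0 < Y) {n : ℕ}
    (h0 : u 0 ≤ K) (hn : u n ≤ K * Y ^ n) {a : ℕ} (ha : a ≤ n) : u a ≤ K * Y ^ a := by
  -- Dividing by `Y ^ j` preserves log-convexity and turns the geometric bound into a constant one.
  set w : ℕ → ℝ := fun j => u j / Y ^ j with hw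
  have hw0 : ∀ j, 0 ≤ w j := fun j => div_nonneg (hu j) (pow_pos hY j).le
  have hwc : ∀ j, w (j + 1) ^ 2 ≤ w j * w (j + 2) := fun j => by
    simp only [hw]
    rw [div_pow, div_mul_div_comm, ← pow_mul, ← pow_add]
    have : (j + 1) * 2 = j + (j + 2) := by ring
    rw [this]
    exact div_le_div_of_nonneg_right (hc j) (pow_pos hY _).le
  suffices h : w a ≤ K by rwa [hw, div_le_iff₀ (pow_pos hY a)] at h
  have hw00 : w 0 ≤ K := by simpa [hw] using h0
  have hwn : w n ≤ K := by rw [hw]; exact (div_le_iff₀ (pow_pos hY n)).2 hn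
  by_contra! hcon
  -- If the bound failed, the maximum of `w` on `0..n` would exceed `K` and so be attained only at
  -- interior indices. At the first such index the left neighbour is strictly smaller and the right
  -- one not larger, against log-convexity.
  obtain ⟨b, hb, hbmax⟩ := Finset.exists_max_image (Finset.range (n + 1)) w ⟨0, by simp⟩
  have hKb : K < w b := hcon.trans_le (hbmax a (by simp; omega))
  have hexm : ∃ m, m ≤ n ∧ w m = w b := ⟨b, by simpa [Nat.lt_succ_iff] using hb, rfl⟩
  classical
  obtain ⟨hm1, hm2⟩ := Nat.find_spec hexm
  set m := Nat.find hexm with hm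
  have hm0 : m ≠ 0 := fun h => by rw [h] at hm2; linarith
  have hmn : m ≠ n := fun h => by rw [h] at hm2; linarith
  obtain ⟨j, hj⟩ := Nat.exists_eq_succ_of_ne_zero hm0
  rw [hj] at hm1 hm2 hmn
  have hlt : w j < w b := lt_of_le_of_ne (hbmax j (by simp; omega)) fun h =>
    Nat.find_min hexm (m := j) (by omega) ⟨by omega, h⟩
  have hle : w (j + 2) ≤ w b := hbmax (j + 2) (by simp; omega)
  have := hwc j
  rw [hm2] at this
  nlinarith [hw0 j, hw0 (j + 2)]

variable {K L Z : ℝ} {n : ℕ}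

/-- The parameter `Z` measures the size of the top derivative. Each derivative costs `Z ^ 2` rather
than `Z`, so that the half derivative lost in passing to the supremum norm costs an integer power.
-/
lemma IsJet.wNorm_le (h : IsJet v f) (hK : 0 < K) (hZ : 1 ≤ Z) (h0 : wNorm v (f 0) ≤ K)
    (hn : wNorm v (f n) ≤ K * Z ^ (2 * n)) {a : ℕ} (ha : a ≤ n) :
    wNorm v (f a) ≤ K * Z ^ (2 * a) := by
  rw [pow_mul] at hn ⊢
  exact le_geometric_of_log_convex (u := fun j => wNorm v (f j)) (fun _ => wNorm_nonneg)
    h.wNorm_sq_le hK (by positivity) h0 hn ha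

/-- The constant in the interpolation inequality for the supremum norm. -/
def supConst (K L : ℝ) : ℝ := K * √(1 / L + 2)

lemma le_supConst (hK : 0 < K) (hL : 0 < L) : K ≤ supConst K L := by
  have : 1 ≤ √(1 / L + 2) := Real.one_le_sqrt.2 (by have := one_div_pos.2 hL; linarith)
  unfold supConst
  nlinarith

/-- The Sobolev inequality involves the norms of orders `a` and `a + 1`, whose product has weight `Z
^ (4 * a + 2)`; hence `a < n` and one extra power of `Z` compared with the `L²` bound. -/
lemma IsJet.abs_le (h : IsJet v f) (hK : 0 < K) (hZ : 1 ≤ Z) (hL : 0 < L)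
    (hLv : L ≤ wInt v fun _ => 1) (h0 : wNorm v (f 0) ≤ K)
    (hn : wNorm v (f n) ≤ K * Z ^ (2 * n)) {a : ℕ} (ha : a < n) (x : ℝ) :
    |f a x| ≤ supConst K L * Z ^ (2 * a + 1) := by
  have h1 := h.wNorm_le hK hZ h0 hn ha.le
  have h2 := h.wNorm_le hK hZ h0 hn (Nat.succ_le_of_lt ha)
  have h3 := sq_mul_length_le h.cont h.pos (h.continuous (a + 1)) (h.hasDerivAt a) (h.periodic a) x
  set ℓ := wInt v fun _ => 1
  have hℓ : 0 < ℓ := hL.trans_le hLv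
  refine abs_le_of_sq_le_sq ?_ (by unfold supConst; positivity)
  have hsq : supConst K L ^ 2 = K ^ 2 * (1 / L + 2) := by
    unfold supConst; rw [mul_pow, Real.sq_sqrt (by positivity)]
  have h4 : wNorm v (f a) ^ 2 ≤ K ^ 2 * Z ^ (4 * a + 2) := by
    calc wNorm v (f a) ^ 2 ≤ (K * Z ^ (2 * a)) ^ 2 := pow_le_pow_left₀ wNorm_nonneg h1 2
      _ = K ^ 2 * Z ^ (4 * a) := by ring
      _ ≤ K ^ 2 * Z ^ (4 * a + 2) := by gcongr; omega
  have h5 : wNorm v (f a) * wNorm v (f (a + 1)) ≤ K ^ 2 * Z ^ (4 * a + 2) := by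
    calc _ ≤ (K * Z ^ (2 * a)) * (K * Z ^ (2 * (a + 1))) :=
          mul_le_mul h1 h2 wNorm_nonneg (by positivity)
      _ = K ^ 2 * Z ^ (4 * a + 2) := by ring
  have h6 : f a x ^ 2 ≤ K ^ 2 * Z ^ (4 * a + 2) * (1 / ℓ + 2) := by
    have : f a x ^ 2 * ℓ ≤ K ^ 2 * Z ^ (4 * a + 2) * (1 / ℓ + 2) * ℓ := by
      have : K ^ 2 * Z ^ (4 * a + 2) * (1 / ℓ + 2) * ℓ
          = K ^ 2 * Z ^ (4 * a + 2) + 2 * ℓ * (K ^ 2 * Z ^ (4 * a + 2)) := by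
        field_simp
      rw [this]
      nlinarith
    exact le_of_mul_le_mul_right this hℓ
  calc f a x ^ 2 ≤ K ^ 2 * Z ^ (4 * a + 2) * (1 / ℓ + 2) := h6
    _ ≤ K ^ 2 * Z ^ (4 * a + 2) * (1 / L + 2) := by gcongr
    _ = (supConst K L * Z ^ (2 * a + 1)) ^ 2 := by rw [mul_pow, hsq]; ring

lemma IsJet.abs_jetProd_le (h : IsJet v f) (hK : 0 < K) (hZ : 1 ≤ Z) (hL : 0 < L)
    (hLv : L ≤ wInt v fun _ => 1) (h0 : wNorm v (f 0) ≤ K)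
    (hn : wNorm v (f n) ≤ K * Z ^ (2 * n)) (x : ℝ) :
    ∀ l : List ℕ, l.sum < n → |jetProd f l x| ≤ supConst K L ^ l.length * Z ^ (2 * l.sum + l.length)
  | [], _ => by simp [jetProd]
  | a :: l, hl => by
    simp only [List.sum_cons] at hl
    have h1 := h.abs_le hK hZ hL hLv h0 hn (a := a) (by omega) x
    have h2 := h.abs_jetProd_le hK hZ hL hLv h0 hn x l (by omega)
    have : jetProd f (a :: l) x = f a x * jetProd f l x := by simp [jetProd]
    rw [this, abs_mul]
    refine (mul_le_mul h1 h2 (abs_nonneg _) ((abs_nonneg _).trans h1)).trans_eq ?_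
    simp only [List.sum_cons, List.length_cons]
    ring

/-- All factors but one are estimated in the supremum norm. The factor kept in `L²` saves one power
of `Z`, which is the factor `Z` on the left. -/
lemma IsJet.wNorm_jetProd_le (h : IsJet v f) (hK : 0 < K) (hZ : 1 ≤ Z) (hL : 0 < L)
    (hLv : L ≤ wInt v fun _ => 1) (h0 : wNorm v (f 0) ≤ K) (hn1 : 1 ≤ n)
    (hn : wNorm v (f n) ≤ K * Z ^ (2 * n)) :
    ∀ l : List ℕ, l ≠ [] → l.sum ≤ n →
      Z * wNorm v (jetProd f l) ≤ supConst K L ^ l.length * Z ^ (2 * l.sum + l.length)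
  | [], hne, _ => absurd rfl hne
  | [a], _, hl => by
    simp only [List.sum_cons, List.sum_nil, add_zero] at hl
    have : jetProd f [a] = f a := by ext x; simp [jetProd]
    have h1 := h.wNorm_le hK hZ h0 hn hl
    have h2 := le_supConst hK hL
    simp only [this, List.sum_cons, List.sum_nil, List.length_cons, List.length_nil]
    calc Z * wNorm v (f a) ≤ Z * (supConst K L * Z ^ (2 * a)) := by
          gcongr; exact h1.trans (by gcongr)
      _ = _ := by ring
  | a :: b :: l, _, hl => by
    rw [List.sum_cons] at hl
    have hM : 0 < supConst K L := hK.trans_le (le_supConst hK hL)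
    have hcons : jetProd f (a :: b :: l) = fun x => f a x * jetProd f (b :: l) x := by
      ext x; simp [jetProd]
    -- The supremum bound is available only below order `n`. If the first factor has order `n`, all
    -- others have order `0` and the first one is the factor kept in `L²`.
    rcases lt_or_ge a n with ha | ha
    · have h1 := h.abs_le hK hZ hL hLv h0 hn ha
      have h2 := h.wNorm_jetProd_le hK hZ hL hLv h0 hn1 hn (b :: l) (by simp) (by omega)
      rw [hcons]
      calc Z * wNorm v (fun x => f a x * jetProd f (b :: l) x)
          ≤ Z * (supConst K L * Z ^ (2 * a + 1) * wNorm v (jetProd f (b :: l))) := by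
            gcongr
            exact wNorm_mul_le h.cont h.pos (h.continuous a) (h.continuous_jetProd _) h1
        _ = supConst K L * Z ^ (2 * a + 1) * (Z * wNorm v (jetProd f (b :: l))) := by ring
        _ ≤ supConst K L * Z ^ (2 * a + 1) *
            (supConst K L ^ (b :: l).length * Z ^ (2 * (b :: l).sum + (b :: l).length)) := by
            gcongr
        _ = _ := by rw [List.sum_cons (a := a), List.length_cons (a := a)]; ring
    · obtain rfl : a = n := by omega
      have hs : (b :: l).sum = 0 := by omega
      have h1 := fun x => h.abs_jetProd_le hK hZ hL hLv h0 hn x (b :: l) (by omega)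
      have h2 := h.wNorm_le hK hZ h0 hn le_rfl
      have hcomm : jetProd f (a :: b :: l) = fun x => jetProd f (b :: l) x * f a x := by
        rw [hcons]; ext x; ring
      rw [hcomm]
      calc Z * wNorm v (fun x => jetProd f (b :: l) x * f a x)
          ≤ Z * (supConst K L ^ (b :: l).length * Z ^ (2 * (b :: l).sum + (b :: l).length)
              * wNorm v (f a)) := by
            gcongr
            exact wNorm_mul_le h.cont h.pos (h.continuous_jetProd _) (h.continuous a) h1
        _ ≤ Z * (supConst K L ^ (b :: l).length * Z ^ (2 * (b :: l).sum + (b :: l).length)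
              * (supConst K L * Z ^ (2 * a))) := by
            gcongr
            exact h2.trans (by gcongr; exact le_supConst hK hL)
        _ = _ := by rw [List.sum_cons (a := a), List.length_cons (a := a)]; ring

end Interpolation

/-! ### Differential polynomials -/

/-- Polynomials in a function and its successive derivatives. -/
abbrev DiffPoly : Type := MvPolynomial ℕ ℝ

namespace DiffPoly

open MvPolynomial

/-- The total derivative, sending each variable to the next one. -/
def D : Derivation ℝ DiffPoly DiffPoly := mkDerivation ℝ fun j => X (j + 1)

@[simp] lemma D_X (j : ℕ) : D (X j) = X (j + 1) := mkDerivation_X _ _ _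

/-- The value of a differential polynomial. -/
def ev (f : ℕ → ℝ → ℝ) (P : DiffPoly) (x : ℝ) : ℝ := aeval (fun j => f j x) P

/-- The monomial which is the product of the variables listed in `l`. -/
def mono (l : List ℕ) : DiffPoly := (l.map X).prod

lemma ev_mono (f : ℕ → ℝ → ℝ) (l : List ℕ) (x : ℝ) : ev f (mono l) x = jetProd f l x := by
  induction l with
  | nil => simp [ev, mono, jetProd]
  | cons a l ih => simp_all [ev, mono, jetProd]

/-- The lists of orders of the monomials that are of lower order with respect to the derivative of
order `n` in the energy estimates. -/
def lowSet (n : ℕ) : Set (List ℕ) := {l | l ≠ [] ∧ l.sum ≤ n ∧ 2 * l.sum + l.length ≤ 2 * n + 3}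

/-- The space of differential polynomials spanned by the monomials in `lowSet n`. -/
def low (n : ℕ) : Submodule ℝ DiffPoly := Submodule.span ℝ (mono '' lowSet n)

lemma mono_mem_low {n : ℕ} {l : List ℕ} (h0 : l ≠ []) (h1 : l.sum ≤ n)
    (h2 : 2 * l.sum + l.length ≤ 2 * n + 3) : mono l ∈ low n :=
  Submodule.subset_span ⟨l, ⟨h0, h1, h2⟩, rfl⟩

/-- The derivative of a monomial is a sum of monomials with one order raised by one. -/
lemma D_mono_mem (l : List ℕ) : D (mono l) ∈ Submodule.span ℝ
    (mono '' {l' | l'.length = l.length ∧ l'.sum = l.sum + 1}) := by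
  induction l with
  | nil => simp [mono]
  | cons a l ih =>
    have h : D (mono (a :: l)) = mono ((a + 1) :: l) + X a * D (mono l) := by
      simp [mono, Derivation.leibniz, mul_comm]
    rw [h]
    refine add_mem (Submodule.subset_span ⟨_, ⟨by simp, by simp; ring⟩, rfl⟩) ?_
    have := Submodule.mem_map_of_mem (f := LinearMap.mulLeft ℝ (X a : DiffPoly)) ih
    rw [Submodule.map_span] at this
    refine Submodule.span_mono ?_ this
    rintro _ ⟨_, ⟨l', ⟨h1, h2⟩, rfl⟩, rfl⟩
    exact ⟨a :: l', ⟨by simp [h1], by simp [h2]; ring⟩, by simp [mono]⟩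

/-- A total derivative keeps the length of a monomial and raises its order sum by one, so both sides
of the weight condition grow by two. -/
lemma D_mem_low {n : ℕ} {P : DiffPoly} (hP : P ∈ low n) : D P ∈ low (n + 1) := by
  induction hP using Submodule.span_induction with
  | mem P hP =>
    obtain ⟨l, ⟨h0, h1, h2⟩, rfl⟩ := hP
    refine Submodule.span_mono ?_ (D_mono_mem l)
    rintro _ ⟨l', ⟨h3, h4⟩, rfl⟩
    refine ⟨l', ⟨?_, by omega, by omega⟩, rfl⟩
    rintro rfl
    exact h0 (List.length_eq_zero_iff.1 h3.symm)
  | zero => simp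
  | add P Q _ _ hP hQ => rw [map_add]; exact add_mem hP hQ
  | smul c P _ hP => rw [Derivation.map_smul]; exact Submodule.smul_mem _ _ hP

/-- The normal velocity of the elastic flow. -/
def vel (μ : ℝ) : DiffPoly := C (-2) * X 2 - X 0 ^ 3 + C μ * X 0

/-- The lower order terms in the evolution equation of the `j`-th derivative of the curvature. -/
def rem (μ : ℝ) : ℕ → DiffPoly
  | 0 => D (D (- X 0 ^ 3 + C μ * X 0)) + X 0 ^ 2 * vel μ
  | j + 1 => D (rem μ j) + X 0 * vel μ * X (j + 1)

/-- The monomial `k k_2 k_j` is critical: its weight `2 (j + 2) + 3` is exactly the largest one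
allowed in `low (j + 2)`. -/
lemma mul_vel_mul_mem_low (μ : ℝ) (j : ℕ) : X 0 * vel μ * X j ∈ low (j + 2) := by
  have h : X 0 * vel μ * X j
      = (-2 : ℝ) • mono [0, 2, j] - mono [0, 0, 0, 0, j] + μ • mono [0, 0, j] := by
    simp only [vel, mono, smul_eq_C_mul, List.map_cons, List.map_nil, List.prod_cons,
      List.prod_nil]
    ring
  rw [h]
  refine add_mem (sub_mem (Submodule.smul_mem _ _ ?_) ?_) (Submodule.smul_mem _ _ ?_) <;>
  refine mono_mem_low (by simp) ?_ ?_ <;> simp <;> omega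

lemma rem_mem_low (μ : ℝ) (j : ℕ) : rem μ j ∈ low (j + 2) := by
  induction j with
  | zero =>
    refine add_mem (D_mem_low (n := 1) (D_mem_low (n := 0) ?_)) ?_
    · have h : (- X 0 ^ 3 + C μ * X 0 : DiffPoly) = - mono [0, 0, 0] + μ • mono [0] := by
        simp only [mono, smul_eq_C_mul, List.map_cons, List.map_nil, List.prod_cons, List.prod_nil]
        ring
      rw [h]
      exact add_mem (neg_mem (mono_mem_low (by simp) (by simp) (by simp)))
        (Submodule.smul_mem _ _ (mono_mem_low (by simp) (by simp) (by simp)))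
    · have := mul_vel_mul_mem_low μ 0
      convert this using 1
      ring
  | succ j ih => exact add_mem (D_mem_low ih) (mul_vel_mul_mem_low μ (j + 1))

lemma exists_bound (P : DiffPoly) (S : ℕ → ℝ) :
    ∃ C, ∀ (f : ℕ → ℝ → ℝ) (x : ℝ), (∀ j, |f j x| ≤ S j) → |ev f P x| ≤ C := by
  induction P using MvPolynomial.induction_on with
  | C a => exact ⟨|a|, fun f x _ => by simp [ev]⟩
  | add P Q hP hQ =>
    obtain ⟨A, hA⟩ := hP
    obtain ⟨B, hB⟩ := hQ
    refine ⟨A + B, fun f x hf => ?_⟩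
    simp only [ev, map_add] at hA hB ⊢
    exact (abs_add_le _ _).trans (add_le_add (hA f x hf) (hB f x hf))
  | mul_X P j hP =>
    obtain ⟨A, hA⟩ := hP
    refine ⟨A * S j, fun f x hf => ?_⟩
    simp only [ev, map_mul, aeval_X] at hA ⊢
    rw [abs_mul]
    exact mul_le_mul (hA f x hf) (hf j) (abs_nonneg _) ((abs_nonneg _).trans (hA f x hf))

lemma hasDerivAt_ev {v : ℝ → ℝ} {f : ℕ → ℝ → ℝ} (h : IsJet v f) (P : DiffPoly) (x : ℝ) :
    HasDerivAt (ev f P) (v x * ev f (D P) x) x := by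
  induction P using MvPolynomial.induction_on with
  | C a =>
    have h1 : ev f (C a) = fun _ => a := by ext; simp [ev]
    have h2 : D (C a) = 0 := Derivation.map_algebraMap D a
    rw [h1, h2]
    simpa [ev] using hasDerivAt_const x a
  | add P Q hP hQ =>
    have h1 : ev f (P + Q) = fun x => ev f P x + ev f Q x := by ext; simp [ev]
    rw [h1]
    refine (hP.add hQ).congr_deriv ?_
    simp [ev, mul_add]
  | mul_X P j hP =>
    have h1 : ev f (P * X j) = fun x => ev f P x * f j x := by ext; simp [ev]
    rw [h1]
    refine (hP.mul (h.hasDerivAt j x)).congr_deriv ?_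
    simp [ev, Derivation.leibniz]
    ring

lemma continuous_ev {v : ℝ → ℝ} {f : ℕ → ℝ → ℝ} (h : IsJet v f) (P : DiffPoly) :
    Continuous (ev f P) :=
  continuous_iff_continuousAt.2 fun x => (hasDerivAt_ev h P x).continuousAt

lemma periodic_ev {v : ℝ → ℝ} {f : ℕ → ℝ → ℝ} (h : IsJet v f) (P : DiffPoly) :
    Function.Periodic (ev f P) 1 := fun x => by
  simp only [ev, fun j => h.periodic j x]

/-- Pairings with lower order differential polynomials are controlled by interpolation. -/
lemma exists_bound_low {n : ℕ} (hn1 : 1 ≤ n) {P : DiffPoly} (hP : P ∈ low n) {K L : ℝ}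
    (hK : 0 < K) (hL : 0 < L) :
    ∃ C, 0 ≤ C ∧ ∀ (v : ℝ → ℝ) (f : ℕ → ℝ → ℝ) (Z : ℝ) (g : ℝ → ℝ), IsJet v f → 1 ≤ Z →
      L ≤ wInt v (fun _ => 1) → wNorm v (f 0) ≤ K → wNorm v (f n) ≤ K * Z ^ (2 * n) →
      Continuous g → Z * |wInt v fun x => g x * ev f P x| ≤ C * Z ^ (2 * n + 3) * wNorm v g := by
  induction hP using Submodule.span_induction with
  | mem P hP =>
    obtain ⟨l, ⟨h0, h1, h2⟩, rfl⟩ := hP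
    have hM : 0 < supConst K L := hK.trans_le (le_supConst hK hL)
    refine ⟨supConst K L ^ l.length, by positivity, ?_⟩
    intro v f Z g h hZ hLv hf0 hfn hg
    have h3 := h.wNorm_jetProd_le hK hZ hL hLv hf0 hn1 hfn l h0 h1
    simp only [ev_mono]
    calc Z * |wInt v fun x => g x * jetProd f l x|
        ≤ Z * (wNorm v g * wNorm v (jetProd f l)) := by
          gcongr
          exact (abs_wInt_le h.cont h.pos (hg.mul (h.continuous_jetProd l))).trans
            (wInt_abs_mul_le h.cont h.pos hg (h.continuous_jetProd l))
      _ = (Z * wNorm v (jetProd f l)) * wNorm v g := by ring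
      -- The weight condition in `lowSet` caps the exponent, as `1 ≤ Z`.
      _ ≤ supConst K L ^ l.length * Z ^ (2 * n + 3) * wNorm v g := by
          refine mul_le_mul_of_nonneg_right (h3.trans ?_) wNorm_nonneg
          gcongr
  | zero => exact ⟨0, le_rfl, fun v f Z g _ _ _ _ _ _ => by simp [ev, wInt]⟩
  | add P Q _ _ hP hQ =>
    obtain ⟨A, hA0, hA⟩ := hP
    obtain ⟨B, hB0, hB⟩ := hQ
    refine ⟨A + B, by positivity, ?_⟩
    intro v f Z g h hZ hLv hf0 hfn hg
    have h1 := hA v f Z g h hZ hLv hf0 hfn hg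
    have h2 := hB v f Z g h hZ hLv hf0 hfn hg
    have h3 : (fun x => g x * ev f (P + Q) x) = fun x => g x * ev f P x + g x * ev f Q x := by
      ext x; simp [ev, mul_add]
    rw [h3, wInt_add h.cont (f := fun x => g x * ev f P x)
      (g := fun x => g x * ev f Q x) (hg.mul (continuous_ev h P))
      (hg.mul (continuous_ev h Q))]
    calc _ ≤ Z * (|wInt v fun x => g x * ev f P x| + |wInt v fun x => g x * ev f Q x|) := by
          gcongr; exact abs_add_le _ _
      _ ≤ (A + B) * Z ^ (2 * n + 3) * wNorm v g := by linarith
  | smul c P _ hP =>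
    obtain ⟨A, hA0, hA⟩ := hP
    refine ⟨|c| * A, by positivity, ?_⟩
    intro v f Z g h hZ hLv hf0 hfn hg
    have h1 := hA v f Z g h hZ hLv hf0 hfn hg
    have h3 : (fun x => g x * ev f (c • P) x) = fun x => c * (g x * ev f P x) := by
      ext x; simp [ev]; ring
    rw [h3, wInt_const_mul, abs_mul]
    nlinarith [abs_nonneg c]

end DiffPoly

/-! ### Differentiation under the integral sign -/

lemma hasDerivAt_integral_of_continuousOn {F F' : ℝ → ℝ → ℝ} {a δ : ℝ} (hδ : 0 < δ)
    (hF : ContinuousOn (Function.uncurry F) (Metric.ball a δ ×ˢ Set.univ))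
    (hF' : ContinuousOn (Function.uncurry F') (Metric.ball a δ ×ˢ Set.univ))
    (hd : ∀ t ∈ Metric.ball a δ, ∀ x, HasDerivAt (fun s => F s x) (F' t x) t) :
    HasDerivAt (fun t => ∫ x in (0 : ℝ)..1, F t x) (∫ x in (0 : ℝ)..1, F' a x) a := by
  have hslice : ∀ G : ℝ → ℝ → ℝ,
      ContinuousOn (Function.uncurry G) (Metric.ball a δ ×ˢ Set.univ) →
      ∀ t ∈ Metric.ball a δ, Continuous (G t) := fun G hG t ht => by
    have : ContinuousOn (fun x : ℝ => Function.uncurry G (t, x)) Set.univ :=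
      hG.comp (by fun_prop) fun x _ => ⟨ht, trivial⟩
    exact continuousOn_univ.1 this
  -- Compactness of the half-radius ball times `[0, 1]` supplies a constant dominating function.
  have hsub : Metric.closedBall a (δ / 2) ⊆ Metric.ball a δ :=
    Metric.closedBall_subset_ball (by linarith)
  obtain ⟨C, hC⟩ := ((isCompact_closedBall a (δ / 2)).prod
    (isCompact_Icc (a := (0 : ℝ)) (b := 1))).exists_bound_of_continuousOn
    (hF'.mono (Set.prod_mono hsub (Set.subset_univ _)))
  have ha : a ∈ Metric.ball a δ := Metric.mem_ball_self hδ
  refine (intervalIntegral.hasDerivAt_integral_of_dominated_loc_of_deriv_le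
    (F := F) (F' := F') (bound := fun _ => C)
    (Metric.ball_mem_nhds a (half_pos hδ)) ?_ ((hslice F hF a ha).intervalIntegrable _ _)
    (hslice F' hF' a ha).aestronglyMeasurable ?_ intervalIntegrable_const ?_).2
  · filter_upwards [Metric.ball_mem_nhds a hδ] with t ht
    exact (hslice F hF t ht).aestronglyMeasurable
  · refine Filter.Eventually.of_forall fun x hx t ht => hC (t, x) ⟨Metric.ball_subset_closedBall ht, ?_⟩
    rw [Set.uIoc_of_le zero_le_one] at hx
    exact Set.Ioc_subset_Icc_self hx
  · exact Filter.Eventually.of_forall fun x _ t ht =>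
      hd t (hsub (Metric.ball_subset_closedBall ht)) x

/-! ### The plane -/

/-- The counterclockwise rotation by `π / 2`. -/
def rot : Plane →L[ℝ] Plane := LinearMap.toContinuousLinearMap
  { toFun := fun u => !₂[-(u 1), u 0]
    map_add' := fun u w => by ext i; fin_cases i <;> simp; ring
    map_smul' := fun c u => by ext i; fin_cases i <;> simp }

lemma rot_apply (u : Plane) : rot u = !₂[-(u 1), u 0] := rfl

lemma inner_plane (u w : Plane) : inner ℝ u w = u 0 * w 0 + u 1 * w 1 := by
  simp [PiLp.inner_apply, Fin.sum_univ_two]; ring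

@[simp] lemma rot_rot (u : Plane) : rot (rot u) = -u := by
  ext i; fin_cases i <;> simp [rot_apply]

@[simp] lemma inner_rot_rot (u w : Plane) : inner ℝ (rot u) (rot w) = inner ℝ u w := by
  simp [inner_plane, rot_apply]; ring

@[simp] lemma inner_self_rot (u : Plane) : inner ℝ u (rot u) = 0 := by
  simp [inner_plane, rot_apply]; ring

@[simp] lemma inner_rot_self (u : Plane) : inner ℝ (rot u) u = 0 := by
  rw [real_inner_comm, inner_self_rot]

/-- The vectors `e` and `rot e` form an orthonormal basis of the plane. -/
lemma eq_smul_rot_of_inner_eq_zero {e u : Plane} (he : inner ℝ e e = 1) (h : inner ℝ u e = 0) :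
    u = inner ℝ u (rot e) • rot e := by
  rw [inner_plane] at he h
  ext i
  fin_cases i <;> simp [inner_plane, rot_apply]
  · linear_combination (-u 0) * he + e 0 * h
  · linear_combination (-u 1) * he + e 1 * h

/-! ### Functions of positive time and space -/

/-- Smoothness on the half plane of positive times. -/
def SmoothPos {F : Type*} [NormedAddCommGroup F] [NormedSpace ℝ F] (f : ℝ × ℝ → F) : Prop :=
  ∀ p : ℝ × ℝ, 0 < p.1 → ContDiffAt ℝ ∞ f p

/-- Periodicity in space at positive times. -/
def PeriodicPos {F : Type*} (f : ℝ × ℝ → F) : Prop :=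
  ∀ p : ℝ × ℝ, 0 < p.1 → f (p.1, p.2 + 1) = f p

/-- The space derivative. -/
def dX {F : Type*} [NormedAddCommGroup F] [NormedSpace ℝ F] (f : ℝ × ℝ → F) (p : ℝ × ℝ) : F :=
  fderiv ℝ f p (0, 1)

/-- The time derivative. -/
def dT {F : Type*} [NormedAddCommGroup F] [NormedSpace ℝ F] (f : ℝ × ℝ → F) (p : ℝ × ℝ) : F :=
  fderiv ℝ f p (1, 0)

section Calculus

variable {F : Type*} [NormedAddCommGroup F] [NormedSpace ℝ F] {f h : ℝ × ℝ → F} {p : ℝ × ℝ}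

lemma pos_mem_nhds (hp : 0 < p.1) : {q : ℝ × ℝ | 0 < q.1} ∈ nhds p :=
  (isOpen_lt continuous_const continuous_fst).mem_nhds hp

lemma SmoothPos.differentiableAt (hf : SmoothPos f) (hp : 0 < p.1) : DifferentiableAt ℝ f p :=
  (hf p hp).differentiableAt (by simp)

lemma SmoothPos.fderiv_apply (hf : SmoothPos f) (ξ : ℝ × ℝ) :
    SmoothPos fun p => fderiv ℝ f p ξ := fun p hp =>
  ((hf p hp).fderiv_right (m := ∞) (by simp)).clm_apply contDiffAt_const

lemma SmoothPos.dX (hf : SmoothPos f) : SmoothPos (dX f) := hf.fderiv_apply _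

lemma SmoothPos.dT (hf : SmoothPos f) : SmoothPos (dT f) := hf.fderiv_apply _

lemma fderiv_congr_pos (hfh : ∀ q : ℝ × ℝ, 0 < q.1 → f q = h q) (hp : 0 < p.1) :
    fderiv ℝ f p = fderiv ℝ h p :=
  Filter.EventuallyEq.fderiv_eq (Filter.mem_of_superset (pos_mem_nhds hp) hfh)

lemma dX_dT (hf : SmoothPos f) (hp : 0 < p.1) : dX (dT f) p = dT (dX f) p := by
  have hd : DifferentiableAt ℝ (fderiv ℝ f) p :=
    ((hf p hp).fderiv_right (m := ∞) (by simp)).differentiableAt (by simp)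
  have hsymm := (hf p hp).isSymmSndFDerivAt
    (by simpa using ENat.LEInfty.out)
  have key : ∀ ξ η : ℝ × ℝ, fderiv ℝ (fun q => fderiv ℝ f q ξ) p η
      = fderiv ℝ (fderiv ℝ f) p η ξ := fun ξ η => by
    rw [fderiv_clm_apply hd (differentiableAt_const _)]
    simp
  unfold dX dT
  rw [key, key]
  exact hsymm _ _

lemma hasDerivAt_slice_space (hf : DifferentiableAt ℝ f p) :
    HasDerivAt (fun x => f (p.1, x)) (dX f p) p.2 :=
  hf.hasFDerivAt.comp_hasDerivAt p.2 ((hasDerivAt_const p.2 p.1).prodMk (hasDerivAt_id p.2))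

lemma hasDerivAt_slice_time (hf : DifferentiableAt ℝ f p) :
    HasDerivAt (fun t => f (t, p.2)) (dT f p) p.1 :=
  hf.hasFDerivAt.comp_hasDerivAt p.1 ((hasDerivAt_id p.1).prodMk (hasDerivAt_const p.1 p.2))

lemma PeriodicPos.fderiv_apply (hp : PeriodicPos f) (ξ : ℝ × ℝ) :
    PeriodicPos fun p => fderiv ℝ f p ξ := fun p hp0 => by
  have h1 : fderiv ℝ (fun q : ℝ × ℝ => f (q + (0, 1))) p = fderiv ℝ f (p + (0, 1)) :=
    fderiv_comp_add_right (0, 1)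
  have h2 : fderiv ℝ (fun q : ℝ × ℝ => f (q + (0, 1))) p = fderiv ℝ f p :=
    fderiv_congr_pos (fun q hq => by
      have := hp q hq
      rwa [show (q.1, q.2 + 1) = q + (0, 1) by ext <;> simp] at this) hp0
  have h3 : (p.1, p.2 + 1) = p + (0, 1) := by ext <;> simp
  simp only
  rw [h3, ← h1, h2]

lemma fderiv_rot {f : ℝ × ℝ → Plane} (hf : DifferentiableAt ℝ f p) (ξ : ℝ × ℝ) :
    fderiv ℝ (fun q => rot (f q)) p ξ = rot (fderiv ℝ f p ξ) := by
  have := (rot.hasFDerivAt (x := f p)).comp p hf.hasFDerivAt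
  have h2 := this.fderiv
  rw [show (fun q => rot (f q)) = (rot ∘ f) from rfl, h2]
  simp

end Calculus

/-! ### Moving curves -/

section Moving

/-- The speed `|∂ₓ g|`. -/
def speed (g : ℝ × ℝ → Plane) (p : ℝ × ℝ) : ℝ := ‖dX g p‖

/-- The arclength derivative. -/
def dS {F : Type*} [NormedAddCommGroup F] [NormedSpace ℝ F] (g : ℝ × ℝ → Plane) (f : ℝ × ℝ → F)
    (p : ℝ × ℝ) : F := (speed g p)⁻¹ • dX f p

/-- The time derivative along the normal motion, where `W` is the tangential velocity. -/
def dN {F : Type*} [NormedAddCommGroup F] [NormedSpace ℝ F] (g : ℝ × ℝ → Plane) (W : ℝ × ℝ → ℝ)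
    (f : ℝ × ℝ → F) (p : ℝ × ℝ) : F := dT f p - W p • dS g f p

/-- The unit tangent. -/
def tau (g : ℝ × ℝ → Plane) : ℝ × ℝ → Plane := dS g g

/-- The unit normal. -/
def nu (g : ℝ × ℝ → Plane) (p : ℝ × ℝ) : Plane := rot (tau g p)

/-- The curvature. -/
def kap (g : ℝ × ℝ → Plane) (p : ℝ × ℝ) : ℝ := inner ℝ (dS g (tau g) p) (nu g p)

/-- A moving family of regular closed curves with normal velocity `V` and tangential
velocity `W`. -/
structure IsMotion (g : ℝ × ℝ → Plane) (V W : ℝ × ℝ → ℝ) : Prop where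
  smooth : SmoothPos g
  smooth_normal : SmoothPos V
  smooth_tangential : SmoothPos W
  periodic : PeriodicPos g
  periodic_tangential : PeriodicPos W
  regular : ∀ p : ℝ × ℝ, 0 < p.1 → dX g p ≠ 0
  motion : ∀ p : ℝ × ℝ, 0 < p.1 → dT g p = V p • nu g p + W p • tau g p

variable {F : Type*} [NormedAddCommGroup F] [NormedSpace ℝ F] {g : ℝ × ℝ → Plane}
  {V W : ℝ × ℝ → ℝ} {f : ℝ × ℝ → F} {p : ℝ × ℝ}

/-- At a fixed point, `dS` and `dN` are the Fréchet derivative evaluated in a fixed direction, so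
product rules are inherited from `fderiv`. -/
lemma dS_eq_fderiv : dS g f p = fderiv ℝ f p ((speed g p)⁻¹ • (0, 1)) := by
  rw [map_smul]; rfl

lemma dN_eq_fderiv :
    dN g W f p = fderiv ℝ f p ((1, 0) - W p • (speed g p)⁻¹ • (0, 1)) := by
  rw [map_sub, map_smul, map_smul]; rfl

lemma dS_congr {h : ℝ × ℝ → F} (hfh : ∀ q : ℝ × ℝ, 0 < q.1 → f q = h q) (hp : 0 < p.1) :
    dS g f p = dS g h p := by
  unfold dS dX
  rw [fderiv_congr_pos hfh hp]

namespace IsMotion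

lemma speed_pos (H : IsMotion g V W) (hp : 0 < p.1) : 0 < speed g p :=
  norm_pos_iff.2 (H.regular p hp)

lemma smooth_speed (H : IsMotion g V W) : SmoothPos (speed g) := fun p hp =>
  (H.smooth.dX p hp).norm ℝ (H.regular p hp)

lemma smooth_dS (H : IsMotion g V W) (hf : SmoothPos f) : SmoothPos (dS g f) := fun p hp =>
  ((H.smooth_speed p hp).inv (H.speed_pos hp).ne').smul (hf.dX p hp)

lemma smooth_tau (H : IsMotion g V W) : SmoothPos (tau g) := H.smooth_dS H.smooth

lemma smooth_nu (H : IsMotion g V W) : SmoothPos (nu g) := fun p hp =>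
  rot.contDiff.contDiffAt.comp p (H.smooth_tau p hp)

lemma smooth_kap (H : IsMotion g V W) : SmoothPos (kap g) := fun p hp =>
  (H.smooth_dS H.smooth_tau p hp).inner ℝ (H.smooth_nu p hp)

lemma periodic_speed (H : IsMotion g V W) : PeriodicPos (speed g) := fun p hp => by
  have := H.periodic.fderiv_apply (0, 1) p hp
  simp only [speed, dX, this]

lemma periodic_dS (H : IsMotion g V W) (hf : PeriodicPos f) : PeriodicPos (dS g f) := fun p hp => by
  have := hf.fderiv_apply (0, 1) p hp
  simp only at this
  simp only [dS, dX, this, H.periodic_speed p hp]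

lemma periodic_tau (H : IsMotion g V W) : PeriodicPos (tau g) := H.periodic_dS H.periodic

lemma periodic_kap (H : IsMotion g V W) : PeriodicPos (kap g) := fun p hp => by
  have h1 := H.periodic_dS H.periodic_tau p hp
  have h2 := H.periodic_tau p hp
  simp only [kap, nu, h1, h2]

lemma inner_tau_tau (H : IsMotion g V W) (hp : 0 < p.1) : inner ℝ (tau g p) (tau g p) = 1 := by
  have h := (H.speed_pos hp).ne'
  rw [real_inner_self_eq_norm_sq, tau, dS, norm_smul, norm_inv, Real.norm_of_nonneg
    (H.speed_pos hp).le]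
  change ((speed g p)⁻¹ * speed g p) ^ 2 = 1
  field_simp

lemma dX_eq (H : IsMotion g V W) (hp : 0 < p.1) : dX f p = speed g p • dS g f p := by
  rw [dS, smul_inv_smul₀ (H.speed_pos hp).ne']

lemma dS_mul {a b : ℝ × ℝ → ℝ} (ha : SmoothPos a) (hb : SmoothPos b)
    (hp : 0 < p.1) : dS g (fun q => a q * b q) p = a p * dS g b p + dS g a p * b p := by
  simp only [dS_eq_fderiv]
  rw [fderiv_fun_mul (ha.differentiableAt hp) (hb.differentiableAt hp)]
  simp; ring

lemma dS_smul {a : ℝ × ℝ → ℝ} (ha : SmoothPos a) (hf : SmoothPos f)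
    (hp : 0 < p.1) : dS g (fun q => a q • f q) p = a p • dS g f p + dS g a p • f p := by
  simp only [dS_eq_fderiv]
  rw [fderiv_fun_smul (ha.differentiableAt hp) (hf.differentiableAt hp)]
  simp

/-- Differentiate `⟨τ, τ⟩ = 1` in the direction `ξ`. -/
lemma inner_fderiv_tau (H : IsMotion g V W) (hp : 0 < p.1) (ξ : ℝ × ℝ) :
    inner ℝ (fderiv ℝ (tau g) p ξ) (tau g p) = 0 := by
  have hd := H.smooth_tau.differentiableAt hp
  have h1 := fderiv_inner_apply ℝ hd hd ξ
  rw [fderiv_congr_pos (h := fun _ => (1 : ℝ)) (fun q hq => H.inner_tau_tau hq) hp] at h1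
  rw [real_inner_comm (tau g p) (fderiv ℝ (tau g) p ξ)] at h1 ⊢
  simp at h1
  linarith

lemma dS_tau (H : IsMotion g V W) (hp : 0 < p.1) : dS g (tau g) p = kap g p • nu g p := by
  have h := H.inner_fderiv_tau hp ((speed g p)⁻¹ • (0, 1))
  rw [← dS_eq_fderiv] at h
  exact eq_smul_rot_of_inner_eq_zero (H.inner_tau_tau hp) h

lemma dS_nu (H : IsMotion g V W) (hp : 0 < p.1) : dS g (nu g) p = -(kap g p • tau g p) := by
  have h : dS g (nu g) p = rot (dS g (tau g) p) := by
    rw [dS_eq_fderiv, dS_eq_fderiv, ← fderiv_rot (H.smooth_tau.differentiableAt hp)]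
    rfl
  rw [h, H.dS_tau hp, map_smul, nu, rot_rot, smul_neg]

lemma dS_dT_self (H : IsMotion g V W) (hp : 0 < p.1) :
    dS g (dT g) p = (dS g V p + W p * kap g p) • nu g p
      + (dS g W p - kap g p * V p) • tau g p := by
  have h1 : dS g (dT g) p = dS g (fun q => V q • nu g q) p + dS g (fun q => W q • tau g q) p := by
    rw [dS_congr H.motion hp]
    simp only [dS_eq_fderiv]
    rw [fderiv_fun_add]
    · rfl
    · exact (H.smooth_normal.differentiableAt hp).smul (H.smooth_nu.differentiableAt hp)
    · exact (H.smooth_tangential.differentiableAt hp).smul (H.smooth_tau.differentiableAt hp)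
  rw [h1, dS_smul H.smooth_normal H.smooth_nu hp, dS_smul H.smooth_tangential H.smooth_tau hp,
    H.dS_nu hp, H.dS_tau hp]
  module

/-- Differentiate `|∂ₓ g|²` and exchange `∂ₜ` with `∂ₓ`: only the tangential component of `∂ₛ ∂ₜ g`
contributes. -/
lemma dT_speed (H : IsMotion g V W) (hp : 0 < p.1) :
    dT (speed g) p = speed g p * (dS g W p - kap g p * V p) := by
  have hd := H.smooth.dX.differentiableAt hp
  have h1 : dT (fun q => speed g q * speed g q) p = dT (fun q => inner ℝ (dX g q) (dX g q)) p := by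
    congr 1
    ext q
    exact (real_inner_self_eq_norm_mul_norm _).symm
  have hs := H.smooth_speed.differentiableAt hp
  unfold dT at h1
  rw [fderiv_fun_mul hs hs, fderiv_inner_apply ℝ hd hd, real_inner_comm (dX g p)] at h1
  change speed g p * dT (speed g) p + speed g p * dT (speed g) p
    = inner ℝ (dX g p) (dT (dX g) p) + inner ℝ (dX g p) (dT (dX g) p) at h1
  have h2 : inner ℝ (dX g p) (dT (dX g) p)
      = speed g p * (speed g p * (dS g W p - kap g p * V p)) := by
    rw [← dX_dT H.smooth hp, H.dX_eq hp (f := dT g), H.dX_eq hp (f := g), H.dS_dT_self hp]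
    change inner ℝ (speed g p • tau g p) _ = _
    simp only [inner_smul_left, inner_smul_right, inner_add_right, H.inner_tau_tau hp, nu,
      inner_self_rot]
    simp
    left; ring
  rw [h2] at h1
  have := (H.speed_pos hp).ne'
  apply mul_left_cancel₀ this
  linarith

/-- The commutator of the normal time derivative and the arclength derivative. -/
lemma dN_dS (H : IsMotion g V W) (hf : SmoothPos f) (hp : 0 < p.1) :
    dN g W (dS g f) p = dS g (dN g W f) p + (kap g p * V p) • dS g f p := by
  have hs := (H.speed_pos hp).ne'
  have hsd := H.smooth_speed.differentiableAt hp
  have h1 : dT (dS g f) p = (speed g p)⁻¹ • dT (dX f) p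
      - ((speed g p)⁻¹ * (dS g W p - kap g p * V p)) • dX f p := by
    have h2 : dT (fun q => (speed g q)⁻¹) p = - (speed g p)⁻¹ * (dS g W p - kap g p * V p) := by
      have := ((hasDerivAt_inv hs).comp_hasFDerivAt p hsd.hasFDerivAt).fderiv
      change fderiv ℝ (Inv.inv ∘ speed g) p (1, 0) = _
      rw [this]
      change - (speed g p ^ 2)⁻¹ * dT (speed g) p = _
      rw [H.dT_speed hp]
      field_simp
    have h3 : dT (dS g f) p = (speed g p)⁻¹ • dT (dX f) p
        + dT (fun q => (speed g q)⁻¹) p • dX f p := by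
      unfold dT
      change fderiv ℝ (fun q => (speed g q)⁻¹ • dX f q) p (1, 0) = _
      rw [fderiv_fun_smul (c := fun q => (speed g q)⁻¹) (hsd.inv hs) (hf.dX.differentiableAt hp)]
      simp
    rw [h3, h2]
    module
  have h4 : dS g (dN g W f) p = (speed g p)⁻¹ • dT (dX f) p
      - (W p • dS g (dS g f) p + dS g W p • dS g f p) := by
    rw [← dX_dT hf hp, ← dS_smul H.smooth_tangential (H.smooth_dS hf) hp]
    change _ = dS g (dT f) p - _
    simp only [dS_eq_fderiv (g := g) (f := fun q => W q • dS g f q),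
      dS_eq_fderiv (g := g) (f := dT f), dS_eq_fderiv (g := g) (f := dN g W f)]
    change fderiv ℝ (fun q => dT f q - W q • dS g f q) p _ = _
    rw [fderiv_fun_sub (hf.dT.differentiableAt hp)]
    · rfl
    · exact (H.smooth_tangential.differentiableAt hp).smul ((H.smooth_dS hf).differentiableAt hp)
  -- The terms in `W` and `∂ₛ W` agree on both sides and cancel; only the contribution of `k V` to
  -- the change of speed is left.
  rw [h4, dN, h1]
  simp only [dS]
  module

/-- The commutator formula applied to `g` itself, whose normal time derivative is `V ν`; the
tangential terms `∓ k V τ` cancel. -/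
lemma dN_tau (H : IsMotion g V W) (hp : 0 < p.1) : dN g W (tau g) p = dS g V p • nu g p := by
  have h1 : ∀ q : ℝ × ℝ, 0 < q.1 → dN g W g q = V q • nu g q := fun q hq => by
    rw [dN, H.motion q hq]
    change _ - W q • tau g q = _
    module
  rw [tau, H.dN_dS H.smooth hp, dS_congr h1 hp, dS_smul H.smooth_normal H.smooth_nu hp,
    H.dS_nu hp]
  change _ + _ • tau g p = _
  module

lemma dN_nu (H : IsMotion g V W) (hp : 0 < p.1) : dN g W (nu g) p = -(dS g V p • tau g p) := by
  have h : dN g W (nu g) p = rot (dN g W (tau g) p) := by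
    rw [dN_eq_fderiv, dN_eq_fderiv, ← fderiv_rot (H.smooth_tau.differentiableAt hp)]
    rfl
  rw [h, H.dN_tau hp, map_smul, nu, rot_rot, smul_neg]

/-- In `k = ⟨∂ₛ τ, ν⟩` the derivative of `ν` is tangential, hence orthogonal to `∂ₛ τ`; the
commutator applied to `τ` gives the rest. -/
lemma dN_kap (H : IsMotion g V W) (hp : 0 < p.1) :
    dN g W (kap g) p = dS g (dS g V) p + kap g p ^ 2 * V p := by
  have h1 : dN g W (kap g) p = inner ℝ (dS g (tau g) p) (dN g W (nu g) p)
      + inner ℝ (dN g W (dS g (tau g)) p) (nu g p) := by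
    simp only [dN_eq_fderiv]
    exact fderiv_inner_apply ℝ ((H.smooth_dS H.smooth_tau).differentiableAt hp)
      (H.smooth_nu.differentiableAt hp) _
  rw [h1, H.dN_dS H.smooth_tau hp, dS_congr (fun q hq => H.dN_tau hq) hp,
    dS_smul (H.smooth_dS H.smooth_normal) H.smooth_nu hp, H.dS_nu hp, H.dN_nu hp, H.dS_tau hp]
  have h2 : inner ℝ (nu g p) (nu g p) = (1 : ℝ) := by
    rw [nu, inner_rot_rot, H.inner_tau_tau hp]
  have h3 : inner ℝ (nu g p) (tau g p) = (0 : ℝ) := inner_rot_self _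
  have h4 : inner ℝ (tau g p) (nu g p) = (0 : ℝ) := inner_self_rot _
  simp only [inner_smul_left, inner_smul_right, inner_add_left, inner_neg_left, inner_neg_right, h2,
    h3, h4]
  simp
  ring

/-- The evolution of integrals with respect to arclength. -/
lemma hasDerivAt_wInt (H : IsMotion g V W) {a : ℝ × ℝ → ℝ} (ha : SmoothPos a)
    (hap : PeriodicPos a) {t : ℝ} (ht : 0 < t) :
    HasDerivAt (fun t => wInt (fun x => speed g (t, x)) fun x => a (t, x))
      (wInt (fun x => speed g (t, x))
        fun x => dN g W a (t, x) - kap g (t, x) * V (t, x) * a (t, x)) t := by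
  set F : ℝ × ℝ → ℝ := fun q => a q * speed g q with hFdef
  have hF : SmoothPos F := fun p hp => (ha p hp).mul (H.smooth_speed p hp)
  have hcont : ∀ {G : ℝ × ℝ → ℝ}, SmoothPos G →
      ContinuousOn (Function.uncurry fun t x => G (t, x)) (Metric.ball t t ×ˢ Set.univ) :=
    fun hG p hp => (hG p (by
      have := hp.1
      rw [Real.ball_eq_Ioo] at this
      linarith [this.1])).continuousAt.continuousWithinAt
  have hmain := hasDerivAt_integral_of_continuousOn (F := fun t x => F (t, x))
    (F' := fun t x => dT F (t, x)) ht (hcont hF) (hcont hF.dT) fun s hs x => by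
      rw [Real.ball_eq_Ioo] at hs
      exact hasDerivAt_slice_time (hF.differentiableAt (p := (s, x)) (by simp; linarith [hs.1]))
  refine hmain.congr_deriv ?_
  have hpos : ∀ x : ℝ, 0 < ((t, x) : ℝ × ℝ).1 := fun _ => ht
  have hslice : ∀ {G : ℝ × ℝ → ℝ}, SmoothPos G → Continuous fun x => G (t, x) := fun hG =>
    continuous_iff_continuousAt.2 fun x =>
      (hasDerivAt_slice_space (hG.differentiableAt (hpos x))).continuousAt
  -- The tangential velocity contributes exactly `∂ₛ (W a)`, the sum of transport and stretching of
  -- the length element, and this integrates to zero over a period.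
  set B : ℝ × ℝ → ℝ := fun q => W q * a q with hBdef
  have hB : SmoothPos B := fun p hp => (H.smooth_tangential p hp).mul (ha p hp)
  have hBp : PeriodicPos B := fun p hp => by
    simp only [hBdef, H.periodic_tangential p hp, hap p hp]
  have h0 : wInt (fun x => speed g (t, x)) (fun x => dS g B (t, x)) = 0 := by
    refine wInt_deriv_eq_zero (f := fun x => B (t, x)) (hslice H.smooth_speed)
      (hslice (H.smooth_dS hB)) (fun x => ?_) fun x => hBp (t, x) ht
    refine (hasDerivAt_slice_space (hB.differentiableAt (hpos x))).congr_deriv ?_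
    rw [H.dX_eq (hpos x)]; rfl
  have hdN : SmoothPos (dN g W a) := fun p hp =>
    (ha.dT p hp).sub ((H.smooth_tangential p hp).smul (H.smooth_dS ha p hp))
  have hc1 := hslice hdN
  have hc2 := hslice H.smooth_kap
  have hc3 := hslice H.smooth_normal
  have hc4 := hslice ha
  have h5 : ∀ x, dT F (t, x) = ((dN g W a (t, x) - kap g (t, x) * V (t, x) * a (t, x))
      + dS g B (t, x)) * speed g (t, x) := fun x => by
    have h6 : dT F (t, x) = a (t, x) * dT (speed g) (t, x) + dT a (t, x) * speed g (t, x) := by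
      unfold dT
      rw [fderiv_fun_mul (ha.differentiableAt (hpos x)) (H.smooth_speed.differentiableAt (hpos x))]
      simp; ring
    rw [h6, H.dT_speed (hpos x), dS_mul H.smooth_tangential ha (hpos x), dN, smul_eq_mul]
    ring
  have h7 : (∫ x in (0 : ℝ)..1, dT F (t, x)) = wInt (fun x => speed g (t, x))
      (fun x => (dN g W a (t, x) - kap g (t, x) * V (t, x) * a (t, x)) + dS g B (t, x)) := by
    unfold wInt
    congr 1
    ext x
    exact h5 x
  rw [h7, wInt_add (hslice H.smooth_speed)
    (f := fun x => dN g W a (t, x) - kap g (t, x) * V (t, x) * a (t, x))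
    (hc1.sub ((hc2.mul hc3).mul hc4))
    (hslice (H.smooth_dS hB)), h0, add_zero]

end IsMotion
end Moving

/-! ### Evolution equations for the elastic flow -/

/-- The arclength derivatives of the curvature. -/
def kapD (g : ℝ × ℝ → Plane) : ℕ → ℝ × ℝ → ℝ
  | 0 => kap g
  | j + 1 => dS g (kapD g j)

/-- The length element at time `t`. -/
def speedAt (g : ℝ × ℝ → Plane) (t x : ℝ) : ℝ := speed g (t, x)

/-- The arclength derivatives of the curvature at time `t`. -/
def jetAt (g : ℝ × ℝ → Plane) (t : ℝ) (j : ℕ) (x : ℝ) : ℝ := kapD g j (t, x)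

/-- A differential polynomial in the curvature. -/
def evAt (g : ℝ × ℝ → Plane) (P : DiffPoly) (p : ℝ × ℝ) : ℝ := DiffPoly.ev (jetAt g p.1) P p.2

/-- A smooth solution of the elastic flow for positive times. -/
structure IsElasticMotion (μ : ℝ) (g : ℝ × ℝ → Plane) (V W : ℝ × ℝ → ℝ) : Prop
    extends IsMotion g V W where
  normal_eq : ∀ p : ℝ × ℝ, 0 < p.1 → V p = evAt g (DiffPoly.vel μ) p

section Evolution

open DiffPoly MvPolynomial

lemma DiffPoly.D_D_vel (μ : ℝ) :
    D (D (vel μ)) = C (-2) * X 4 + D (D (- X 0 ^ 3 + C μ * X 0)) := by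
  have : vel μ = (-2 : ℝ) • X 2 + (- X 0 ^ 3 + C μ * X 0) := by
    simp only [vel, smul_eq_C_mul]; ring
  rw [this, map_add, map_add, Derivation.map_smul, Derivation.map_smul, D_X, D_X, smul_eq_C_mul]

variable {μ : ℝ} {g : ℝ × ℝ → Plane} {V W : ℝ × ℝ → ℝ} {p : ℝ × ℝ} {t : ℝ}

namespace IsMotion

lemma smooth_kapD (H : IsMotion g V W) : ∀ j, SmoothPos (kapD g j)
  | 0 => H.smooth_kap
  | j + 1 => H.smooth_dS (H.smooth_kapD j)

lemma periodic_kapD (H : IsMotion g V W) : ∀ j, PeriodicPos (kapD g j)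
  | 0 => H.periodic_kap
  | j + 1 => H.periodic_dS (H.periodic_kapD j)

lemma continuous_slice {F : Type*} [NormedAddCommGroup F] [NormedSpace ℝ F] {f : ℝ × ℝ → F}
    (hf : SmoothPos f) (ht : 0 < t) : Continuous fun x => f (t, x) :=
  continuous_iff_continuousAt.2 fun x =>
    (hasDerivAt_slice_space (hf.differentiableAt (p := (t, x)) ht)).continuousAt

lemma hasDerivAt_space (H : IsMotion g V W) {F : Type*} [NormedAddCommGroup F] [NormedSpace ℝ F]
    {f : ℝ × ℝ → F} (hf : SmoothPos f) (ht : 0 < t) (x : ℝ) :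
    HasDerivAt (fun x => f (t, x)) (speed g (t, x) • dS g f (t, x)) x := by
  have := hasDerivAt_slice_space (hf.differentiableAt (p := (t, x)) ht)
  rwa [H.dX_eq ht] at this

lemma isJet (H : IsMotion g V W) (ht : 0 < t) : IsJet (speedAt g t) (jetAt g t) where
  cont := continuous_slice H.smooth_speed ht
  pos x := H.speed_pos (p := (t, x)) ht
  hasDerivAt j x := H.hasDerivAt_space (H.smooth_kapD j) ht x
  periodic j x := H.periodic_kapD j (t, x) ht

lemma smooth_evAt (H : IsMotion g V W) (P : DiffPoly) : SmoothPos (evAt g P) := by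
  intro p hp
  induction P using MvPolynomial.induction_on with
  | C a =>
    have : evAt g (C a) = fun _ => a := by ext; simp [evAt, ev]
    rw [this]; exact contDiffAt_const
  | add P Q hP hQ =>
    have : evAt g (P + Q) = fun p => evAt g P p + evAt g Q p := by ext; simp [evAt, ev]
    rw [this]; exact hP.add hQ
  | mul_X P j hP =>
    have : evAt g (P * X j) = fun p => evAt g P p * kapD g j p := by
      ext; simp [evAt, ev, jetAt]
    rw [this]; exact hP.mul (H.smooth_kapD j p hp)

lemma dS_evAt (H : IsMotion g V W) (P : DiffPoly) (hp : 0 < p.1) :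
    dS g (evAt g P) p = evAt g (D P) p := by
  have h1 := hasDerivAt_slice_space ((H.smooth_evAt P).differentiableAt hp)
  have h2 := hasDerivAt_ev (H.isJet hp) P p.2
  rw [dS, h1.unique h2, smul_eq_mul]
  exact inv_mul_cancel_left₀ (H.speed_pos hp).ne' _

end IsMotion

namespace IsElasticMotion

/-- Induction from `dN k = ∂ₛ² V + k² V`. Each further arclength derivative is commuted past `dN` at
the cost of `k V k_{j+1}`, the term added in the recursion for `rem`. -/
lemma dN_kapD (H : IsElasticMotion μ g V W) (j : ℕ) (hp : 0 < p.1) :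
    dN g W (kapD g j) p = evAt g (C (-2) * X (j + 4) + rem μ j) p := by
  have M := H.toIsMotion
  induction j generalizing p with
  | zero =>
    have h1 : ∀ q : ℝ × ℝ, 0 < q.1 → dS g V q = evAt g (D (vel μ)) q := fun q hq => by
      rw [dS_congr H.normal_eq hq, M.dS_evAt _ hq]
    rw [kapD, M.dN_kap hp, dS_congr h1 hp, M.dS_evAt _ hp, H.normal_eq p hp, D_D_vel, rem]
    simp [evAt, ev, jetAt, kapD]
    ring
  | succ j ih =>
    rw [kapD, M.dN_dS (M.smooth_kapD j) hp, dS_congr (fun q hq => ih hq) hp, M.dS_evAt _ hp,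
      H.normal_eq p hp, rem]
    have h2 : D (C (-2) * X (j + 4) + rem μ j) = C (-2) * X (j + 1 + 4) + D (rem μ j) := by
      rw [← smul_eq_C_mul, map_add, Derivation.map_smul, D_X, smul_eq_C_mul]
    rw [h2]
    simp [evAt, ev, jetAt, kapD]
    ring

/-- Integrals of total derivatives vanish. -/
lemma _root_.ElasticFlow.IsMotion.wInt_ev_D (H : IsMotion g V W) (P : DiffPoly) (ht : 0 < t) :
    wInt (speedAt g t) (ev (jetAt g t) (D P)) = 0 :=
  wInt_deriv_eq_zero (H.isJet ht).cont (continuous_ev (H.isJet ht) _)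
    (hasDerivAt_ev (H.isJet ht) P) (periodic_ev (H.isJet ht) P)

/-- The lower order terms in the evolution of the `L²` norm of the `j`-th derivative. -/
def lowRem (μ : ℝ) (j : ℕ) : DiffPoly := (2 : ℝ) • rem μ j - X 0 * vel μ * X j

lemma lowRem_mem_low (μ : ℝ) (j : ℕ) : lowRem μ j ∈ low (j + 2) :=
  sub_mem (Submodule.smul_mem _ _ (rem_mem_low μ j)) (mul_vel_mul_mem_low μ j)

/-- The form before integration by parts, with `k_{j+4}` still present. It serves both the higher
order estimates and, for `j = 0`, the energy identity, which integrate by parts differently. -/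
lemma hasDerivAt_wInt_sq_aux (H : IsElasticMotion μ g V W) (j : ℕ) (ht : 0 < t) :
    HasDerivAt (fun t => wInt (speedAt g t) fun x => jetAt g t j x ^ 2)
      (wInt (speedAt g t) (ev (jetAt g t)
        (C 2 * X j * (C (-2) * X (j + 4) + rem μ j) - X 0 * vel μ * X j ^ 2))) t := by
  have M := H.toIsMotion
  have hk := M.smooth_kapD j
  have hd := M.hasDerivAt_wInt (a := fun p => kapD g j p * kapD g j p)
    (fun p hp => (hk p hp).mul (hk p hp))
    (fun p hp => by simp only [M.periodic_kapD j p hp]) ht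
  refine (hd.congr_deriv ?_).congr_of_eventuallyEq (Filter.Eventually.of_forall fun s => ?_)
  · unfold wInt
    congr 1
    ext x
    congr 1
    have h1 : dN g W (fun p => kapD g j p * kapD g j p) (t, x)
        = 2 * kapD g j (t, x) * dN g W (kapD g j) (t, x) := by
      simp only [dN_eq_fderiv]
      have hdj := hk.differentiableAt (p := (t, x)) ht
      rw [fderiv_fun_mul hdj hdj, add_apply, smul_apply, smul_eq_mul]
      ring
    beta_reduce
    rw [h1, H.dN_kapD j ht, H.normal_eq _ ht]
    simp [evAt, ev, jetAt, kapD]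
    left; ring
  · simp only [pow_two, jetAt]
    rfl

lemma hasDerivAt_wInt_sq (H : IsElasticMotion μ g V W) (j : ℕ) (ht : 0 < t) :
    HasDerivAt (fun t => wInt (speedAt g t) fun x => jetAt g t j x ^ 2)
      (-4 * wNorm (speedAt g t) (jetAt g t (j + 2)) ^ 2
        + wInt (speedAt g t) fun x => jetAt g t j x * ev (jetAt g t) (lowRem μ j) x) t := by
  have M := H.toIsMotion
  refine (H.hasDerivAt_wInt_sq_aux j ht).congr_deriv ?_
  have hJ := M.isJet ht
  -- Adding this total derivative amounts to integrating by parts twice: `-4 k_j k_{j+4}` becomes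
  -- `-4 k_{j+2}²`.
  set Q : DiffPoly := (4 : ℝ) • (X (j + 1) * X (j + 2) - X j * X (j + 3)) with hQ
  have hDQ : D Q = C 4 * (X (j + 2) ^ 2 - X j * X (j + 4)) := by
    rw [hQ, Derivation.map_smul, map_sub, Derivation.leibniz, Derivation.leibniz]
    simp only [D_X, smul_eq_mul, smul_eq_C_mul]
    ring
  have h0 := M.wInt_ev_D Q ht
  have hc := hJ.continuous
  have hcR := continuous_ev hJ (lowRem μ j)
  have hcD := continuous_ev hJ (D Q)
  have h1 : ev (jetAt g t) (C 2 * X j * (C (-2) * X (j + 4) + rem μ j) - X 0 * vel μ * X j ^ 2)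
      = fun x => (-4 * jetAt g t (j + 2) x ^ 2 + jetAt g t j x * ev (jetAt g t) (lowRem μ j) x)
        + ev (jetAt g t) (D Q) x := by
    ext x
    rw [hDQ]
    simp [ev, lowRem]
    ring
  rw [h1, wInt_add hJ.cont
    (f := fun x => -4 * jetAt g t (j + 2) x ^ 2 + jetAt g t j x * ev (jetAt g t) (lowRem μ j) x)
    (by fun_prop) hcD, h0, wInt_add hJ.cont (f := fun x => -4 * jetAt g t (j + 2) x ^ 2)
    (by fun_prop) (by fun_prop), wInt_const_mul, wNorm_sq hJ.pos, add_zero]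

lemma hasDerivAt_length (H : IsElasticMotion μ g V W) (ht : 0 < t) :
    HasDerivAt (fun t => wInt (speedAt g t) fun _ => 1)
      (wInt (speedAt g t) (ev (jetAt g t) (- (X 0 * vel μ)))) t := by
  have hd := H.toIsMotion.hasDerivAt_wInt (a := fun _ => 1) (fun p hp => contDiffAt_const)
    (fun p hp => rfl) ht
  refine hd.congr_deriv ?_
  unfold wInt
  congr 1
  ext x
  beta_reduce
  rw [H.normal_eq _ ht, dN_eq_fderiv]
  simp [evAt, ev, jetAt, kapD, speedAt]

/-- The elastic energy at time `t`. -/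
def energyAt (μ : ℝ) (g : ℝ × ℝ → Plane) (t : ℝ) : ℝ :=
  wNorm (speedAt g t) (jetAt g t 0) ^ 2 + μ * wInt (speedAt g t) fun _ => 1

/-- The elastic flow is the `L²` gradient flow of the elastic energy. -/
lemma hasDerivAt_energyAt (H : IsElasticMotion μ g V W) (ht : 0 < t) :
    HasDerivAt (energyAt μ g) (- wNorm (speedAt g t) (ev (jetAt g t) (vel μ)) ^ 2) t := by
  have M := H.toIsMotion
  have hJ := M.isJet ht
  have hd := (H.hasDerivAt_wInt_sq_aux 0 ht).add ((H.hasDerivAt_length ht).const_mul μ)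
  refine (hd.congr_deriv ?_).congr_of_eventuallyEq ?_
  -- Modulo `D Q` the integrand `2 k ∂ₛ²V + k³ V` equals `V (2 ∂ₛ²k + k³) = -V² + μ k V`, and `μ k
  -- V` cancels against `μ` times the derivative of the length.
  · set Q : DiffPoly := (2 : ℝ) • (X 0 * D (vel μ) - X 1 * vel μ) with hQ
    have h0 := M.wInt_ev_D Q ht
    have hDQ : D Q = C 2 * (X 0 * D (D (vel μ)) - X 2 * vel μ) := by
      rw [hQ, Derivation.map_smul, map_sub, Derivation.leibniz, Derivation.leibniz]
      simp only [D_X, smul_eq_mul, smul_eq_C_mul]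
      ring
    have hc := fun P => continuous_ev hJ P
    have h1 : ev (jetAt g t) (C 2 * X 0 * (C (-2) * X (0 + 4) + rem μ 0) - X 0 * vel μ * X 0 ^ 2)
        = fun x => (-1 * ev (jetAt g t) (vel μ) x ^ 2
          + (-μ) * ev (jetAt g t) (- (X 0 * vel μ)) x) + ev (jetAt g t) (D Q) x := by
      ext x
      rw [hDQ, D_D_vel, rem]
      simp [ev, vel]
      ring
    have hc1 := hc (vel μ)
    have hc2 := hc (- (X 0 * vel μ))
    rw [h1, wInt_add hJ.cont (f := fun x => -1 * ev (jetAt g t) (vel μ) x ^ 2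
          + (-μ) * ev (jetAt g t) (- (X 0 * vel μ)) x) (by fun_prop) (hc _), h0,
      wInt_add hJ.cont (f := fun x => -1 * ev (jetAt g t) (vel μ) x ^ 2)
        (by fun_prop) (by fun_prop), wInt_const_mul, wInt_const_mul, wNorm_sq hJ.pos]
    ring
  · filter_upwards [lt_mem_nhds ht] with s hs
    simp only [energyAt, wNorm_sq (M.isJet hs).pos, Pi.add_apply]

end IsElasticMotion

end Evolution

/-! ### Uniform bounds along the flow -/

section Bounds

open DiffPoly

variable {μ : ℝ} {g : ℝ × ℝ → Plane} {V W : ℝ × ℝ → ℝ} {t : ℝ}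

open IsMotion in
/-- A closed curve has total absolute curvature at least `1`. -/
lemma IsMotion.one_le_mul_length (H : IsMotion g V W) (ht : 0 < t) :
    1 ≤ wNorm (speedAt g t) (jetAt g t 0) ^ 2 * wInt (speedAt g t) fun _ => 1 := by
  have hJ := H.isJet ht
  set v := speedAt g t with hv
  set T : ℝ → Plane := fun x => tau g (t, x) with hT
  have hTd : ∀ x, HasDerivAt T (v x • kap g (t, x) • nu g (t, x)) x := fun x => by
    have := H.hasDerivAt_space H.smooth_tau ht x
    rwa [H.dS_tau ht] at this
  have hTc : Continuous T := continuous_slice H.smooth_tau ht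
  have hTd' : Continuous fun x => v x • kap g (t, x) • nu g (t, x) :=
    hJ.cont.smul ((continuous_slice H.smooth_kap ht).smul (continuous_slice H.smooth_nu ht))
  have hkc := hJ.continuous 0
  have hvc := hJ.cont
  have hunit : ∀ x, inner ℝ (T x) (T x) = (1 : ℝ) := fun x => H.inner_tau_tau (p := (t, x)) ht
  have hnorm : ∀ x, ‖v x • kap g (t, x) • nu g (t, x)‖ = |jetAt g t 0 x * 1| * v x := fun x => by
    have h1 : ‖nu g (t, x)‖ = 1 := by
      have : ‖nu g (t, x)‖ ^ 2 = 1 := by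
        rw [← real_inner_self_eq_norm_sq, nu, inner_rot_rot]; exact hunit x
      exact (pow_eq_one_iff_of_nonneg (norm_nonneg _) two_ne_zero).1 this
    rw [norm_smul, norm_smul, h1, Real.norm_of_nonneg (hJ.pos x).le, Real.norm_eq_abs]
    simp only [jetAt, kapD, mul_one]
    ring
  suffices h : 1 ≤ wInt v fun x => |jetAt g t 0 x * 1| by
    have h2 := h.trans (wInt_abs_mul_le hJ.cont hJ.pos hkc continuous_const)
    have h3 : wNorm v (fun _ => (1 : ℝ)) ^ 2 = wInt v fun _ => 1 := by
      rw [wNorm_sq hJ.pos]; simp only [one_pow]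
    rw [← h3, ← mul_pow]
    exact one_le_pow₀ h2
  -- If `∫ |k| ds < 1`, the tangent stays at distance less than `1` from its initial value `T 0`, so
  -- `⟨T, T 0⟩ > 0`. The curve then advances strictly in the direction `T 0` and cannot close up.
  by_contra! hlt
  have hclose : ∀ x ∈ Set.Icc (0 : ℝ) 1, ‖T x - T 0‖ < 1 := fun x hx => by
    rw [← intervalIntegral.integral_eq_sub_of_hasDerivAt (fun y _ => hTd y)
      (hTd'.intervalIntegrable _ _)]
    refine (norm_integral_le_integral_zero_one hTd' ⟨le_rfl, zero_le_one⟩ hx).trans_lt ?_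
    simp only [hnorm]
    exact hlt
  have hpos : ∀ x ∈ Set.Icc (0 : ℝ) 1, 0 < inner ℝ (T x) (T 0) := fun x hx => by
    have h1 := hclose x hx
    have h2 : ‖T x - T 0‖ ^ 2 < 1 := by nlinarith [norm_nonneg (T x - T 0)]
    rw [← real_inner_self_eq_norm_sq, inner_sub_left, inner_sub_right, inner_sub_right, hunit,
      hunit, real_inner_comm (T x) (T 0)] at h2
    linarith
  have hd : ∀ x, HasDerivAt (fun x => inner ℝ (g (t, x)) (T 0)) (inner ℝ (T x) (T 0) * v x) x :=
    fun x => by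
      have := (H.hasDerivAt_space H.smooth ht x).inner ℝ (hasDerivAt_const x (T 0))
      refine this.congr_deriv ?_
      rw [inner_zero_right, zero_add, real_inner_smul_left]
      exact mul_comm _ _
  have hic : Continuous fun x => inner ℝ (T x) (T 0) * v x :=
    (hTc.inner continuous_const).mul hJ.cont
  have h0 := intervalIntegral.integral_eq_sub_of_hasDerivAt (a := 0) (b := 1) (fun x _ => hd x)
    (hic.intervalIntegrable _ _)
  have h1 : g (t, 1) = g (t, 0) := by simpa using H.periodic (t, 0) ht
  rw [h1, sub_self] at h0
  have h2 := intervalIntegral.integral_pos zero_lt_one hic.continuousOn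
    (fun x hx => (mul_pos (hpos x (Set.Ioc_subset_Icc_self hx)) (hJ.pos x)).le)
    ⟨0, ⟨le_rfl, zero_le_one⟩, mul_pos (hpos 0 ⟨le_rfl, zero_le_one⟩) (hJ.pos 0)⟩
  linarith

lemma exists_one_le_pow_eq {u : ℝ} (hu : 1 ≤ u) {n : ℕ} (hn : n ≠ 0) : ∃ Z : ℝ, 1 ≤ Z ∧ Z ^ n = u :=
  ⟨u ^ ((n : ℝ)⁻¹), Real.one_le_rpow hu (by positivity),
    Real.rpow_inv_natCast_pow (zero_le_one.trans hu) hn⟩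

/-- Absorption of the lower power: for `Z ≥ B / A` the left side is nonpositive, and otherwise `Z`
itself is bounded by `B / A`. -/
lemma mul_pow_le_of_one_le {A B Z : ℝ} (hA : 0 < A) (hB : 0 ≤ B) (hZ : 1 ≤ Z) (m : ℕ) :
    B * Z ^ m - A * Z ^ (m + 2) ≤ B * (B / A) ^ m := by
  have hpos : 0 ≤ B * (B / A) ^ m := by positivity
  have hZm : 0 < Z ^ m := by positivity
  rcases le_or_gt (B / A) Z with h | h
  · rw [div_le_iff₀ hA] at h
    have h1 : B ≤ A * Z ^ 2 := by nlinarith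
    have h2 : B * Z ^ m - A * Z ^ (m + 2) = (B - A * Z ^ 2) * Z ^ m := by ring
    rw [h2]
    nlinarith
  · have : B * Z ^ m ≤ B * (B / A) ^ m := by gcongr
    have : 0 ≤ A * Z ^ (m + 2) := by positivity
    linarith

/-- A Gronwall inequality for `y' ≤ C - y`. -/
lemma le_of_deriv_add_le {y y' : ℝ → ℝ} {C : ℝ} (hd : ∀ t, 1 ≤ t → HasDerivAt y (y' t) t)
    (hle : ∀ t, 1 ≤ t → y' t + y t ≤ C) {t : ℝ} (ht : 1 ≤ t) : y t ≤ C + |y 1 - C| := by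
  have hd' : ∀ s, 1 ≤ s → HasDerivAt (fun s => (y s - C) * Real.exp s)
      (y' s * Real.exp s + (y s - C) * Real.exp s) s := fun s hs =>
    ((hd s hs).sub_const C).mul (Real.hasDerivAt_exp s)
  have hanti : AntitoneOn (fun s => (y s - C) * Real.exp s) (Set.Ici 1) := by
    refine antitoneOn_of_deriv_nonpos (convex_Ici 1)
      (fun s hs => (hd' s hs).continuousAt.continuousWithinAt)
      (fun s hs => (hd' s (interior_subset hs)).differentiableAt.differentiableWithinAt) ?_
    intro s hs
    have hs1 := interior_subset hs
    rw [(hd' s hs1).deriv, ← add_mul]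
    exact mul_nonpos_of_nonpos_of_nonneg (by linarith [hle s hs1]) (Real.exp_pos s).le
  have h1 := hanti (Set.mem_Ici.2 le_rfl) ht ht
  have h2 : Real.exp 1 ≤ Real.exp t := Real.exp_le_exp.2 ht
  have h3 : (y 1 - C) * Real.exp 1 ≤ |y 1 - C| * Real.exp t :=
    mul_le_mul (le_abs_self _) h2 (Real.exp_pos _).le (abs_nonneg _)
  have h4 : (y t - C) ≤ |y 1 - C| := le_of_mul_le_mul_right (h1.trans h3) (Real.exp_pos t)
  linarith

namespace IsElasticMotion

lemma energyAt_le (H : IsElasticMotion μ g V W) (ht : 1 ≤ t) :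
    energyAt μ g t ≤ energyAt μ g 1 := by
  have hd : ∀ s, 1 ≤ s → HasDerivAt (energyAt μ g) _ s := fun s hs =>
    H.hasDerivAt_energyAt (by linarith)
  refine antitoneOn_of_deriv_nonpos (convex_Ici 1)
    (fun s hs => (hd s hs).continuousAt.continuousWithinAt)
    (fun s hs => (hd s (interior_subset hs)).differentiableAt.differentiableWithinAt)
    (fun s hs => ?_) (Set.mem_Ici.2 le_rfl) ht ht
  rw [(hd s (interior_subset hs)).deriv]
  exact neg_nonpos.2 (sq_nonneg _)

/-- Uniform geometric bounds from the decrease of the energy. -/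
lemma exists_basic_bounds (H : IsElasticMotion μ g V W) (hμ : 0 < μ) :
    ∃ K L M : ℝ, 0 < K ∧ 0 < L ∧ ∀ t, 1 ≤ t → wNorm (speedAt g t) (jetAt g t 0) ≤ K ∧
      L ≤ wInt (speedAt g t) (fun _ => 1) ∧ wInt (speedAt g t) (fun _ => 1) ≤ M := by
  set E := energyAt μ g 1 with hE
  have hlen : ∀ t, 1 ≤ t → 0 ≤ wInt (speedAt g t) fun _ => 1 := fun t ht =>
    wInt_nonneg (H.isJet (zero_lt_one.trans_le ht)).pos fun _ => zero_le_one
  have hone : ∀ t : ℝ, 1 ≤ t → _ := fun t ht =>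
    H.toIsMotion.one_le_mul_length (zero_lt_one.trans_le ht)
  have hkE : ∀ t, 1 ≤ t → wNorm (speedAt g t) (jetAt g t 0) ^ 2 ≤ E := fun t ht => by
    have h1 : energyAt μ g t ≤ E := H.energyAt_le ht
    have h2 := mul_nonneg hμ.le (hlen t ht)
    rw [energyAt] at h1
    linarith
  have hEpos : 0 < E := by
    have h1 := hone 1 le_rfl
    have h2 := hkE 1 le_rfl
    have h3 := hlen 1 le_rfl
    by_contra! hcon
    nlinarith
  -- Both terms of the energy are nonnegative, so `∫ k² ≤ E` and `μ ℓ ≤ E`; then `1 ≤ (∫ k²) ℓ`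
  -- forces `ℓ ≥ 1 / E`.
  refine ⟨√E, 1 / E, E / μ, Real.sqrt_pos.2 hEpos, by positivity, fun t ht => ⟨?_, ?_, ?_⟩⟩
  · exact Real.le_sqrt_of_sq_le (hkE t ht)
  · rw [div_le_iff₀ hEpos]
    have h1 := hone t ht
    nlinarith [hkE t ht, hlen t ht]
  · rw [le_div_iff₀ hμ]
    have h1 : energyAt μ g t ≤ E := H.energyAt_le ht
    rw [energyAt] at h1
    nlinarith [sq_nonneg (wNorm (speedAt g t) (jetAt g t 0))]

/-- The `L²` norms of all derivatives of the curvature stay bounded. -/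
lemma exists_wNorm_le (H : IsElasticMotion μ g V W) (hμ : 0 < μ) (j : ℕ) :
    ∃ C, ∀ t, 1 ≤ t → wNorm (speedAt g t) (jetAt g t j) ≤ C := by
  obtain ⟨K, L, M, hK, hL, hb⟩ := H.exists_basic_bounds hμ
  obtain ⟨C, hC0, hC⟩ := exists_bound_low (n := j + 2) (by omega)
    (lowRem_mem_low μ j) hK hL
  set y : ℝ → ℝ := fun t => wInt (speedAt g t) fun x => jetAt g t j x ^ 2 with hy
  have hpos : ∀ t, 1 ≤ t → (0 : ℝ) < t := fun t ht => zero_lt_one.trans_le ht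
  have hd : ∀ t, 1 ≤ t → HasDerivAt y _ t := fun t ht => H.hasDerivAt_wInt_sq j (hpos t ht)
  -- `C * K` comes from the lower order terms and `K ^ 2` from the summand `y t`, added for
  -- Gronwall; both are bounded with the power `Z ^ (4 * j + 6)`.
  set B := C * K + K ^ 2 with hB
  have hB0 : 0 ≤ B := by positivity
  set C' := 4 * K ^ 2 + B * (B / (4 * K ^ 2)) ^ (4 * j + 6) with hC'
  have hle : ∀ t, 1 ≤ t → (-4 * wNorm (speedAt g t) (jetAt g t (j + 2)) ^ 2
      + wInt (speedAt g t) fun x => jetAt g t j x * ev (jetAt g t) (lowRem μ j) x) + y t ≤ C' := by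
    intro t ht
    have hJ := H.isJet (hpos t ht)
    obtain ⟨h0, hLv, -⟩ := hb t ht
    set N := wNorm (speedAt g t) (jetAt g t (j + 2)) with hN
    have hN0 : 0 ≤ N := wNorm_nonneg
    -- `Z` is chosen so that `K * Z ^ (2 * (j + 2))` is the larger of `K` and `N`.
    obtain ⟨Z, hZ, hZu⟩ := exists_one_le_pow_eq (le_max_left 1 (N / K))
      (n := 2 * (j + 2)) (by omega)
    have hZ0 : 0 < Z := by positivity
    have hNZ : N ≤ K * Z ^ (2 * (j + 2)) := by
      rw [hZu, mul_comm, ← div_le_iff₀ hK]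
      exact le_max_right _ _
    have hj := hJ.wNorm_le hK hZ h0 hNZ (a := j) (by omega)
    have hI := hC _ _ Z _ hJ hZ hLv h0 hNZ (hJ.continuous j)
    set I := wInt (speedAt g t) fun x => jetAt g t j x * ev (jetAt g t) (lowRem μ j) x
    -- The exponent is `(2 (j + 2) + 3) + 2 j - 1 = 4 j + 6`, two less than the exponent `4 j + 8`
    -- provided by `N ^ 2`.
    have hI2 : I ≤ C * K * Z ^ (4 * j + 6) := by
      refine (le_abs_self I).trans (le_of_mul_le_mul_left ?_ hZ0)
      calc Z * |I| ≤ C * Z ^ (2 * (j + 2) + 3) * wNorm (speedAt g t) (jetAt g t j) := hI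
        _ ≤ C * Z ^ (2 * (j + 2) + 3) * (K * Z ^ (2 * j)) := by gcongr
        _ = Z * (C * K * Z ^ (4 * j + 6)) := by ring
    have hy2 : y t ≤ K ^ 2 * Z ^ (4 * j + 6) := by
      calc y t = wNorm (speedAt g t) (jetAt g t j) ^ 2 := (wNorm_sq hJ.pos).symm
        _ ≤ (K * Z ^ (2 * j)) ^ 2 := pow_le_pow_left₀ wNorm_nonneg hj 2
        _ = K ^ 2 * Z ^ (4 * j) := by ring
        _ ≤ K ^ 2 * Z ^ (4 * j + 6) := by gcongr; omega
    -- The `-1` covers the case `N ≤ K`, where `Z ^ (2 * (j + 2)) = 1`.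
    have hN2 : K ^ 2 * (Z ^ (4 * j + 6 + 2) - 1) ≤ N ^ 2 := by
      have hZ2 : Z ^ (4 * j + 6 + 2) = (Z ^ (2 * (j + 2))) ^ 2 := by ring
      rw [hZ2, hZu]
      rcases max_cases 1 (N / K) with ⟨h, _⟩ | ⟨h, _⟩ <;> rw [h]
      · simp; positivity
      · rw [div_pow, mul_sub, mul_div_cancel₀ _ (by positivity)]
        linarith [sq_nonneg K]
    have hfin := mul_pow_le_of_one_le (A := 4 * K ^ 2) (by positivity) hB0 hZ (4 * j + 6)
    have hsum : I + y t ≤ B * Z ^ (4 * j + 6) := by rw [hB, add_mul]; linarith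
    rw [hC']
    linarith
  refine ⟨√(C' + |y 1 - C'|), fun t ht => Real.le_sqrt_of_sq_le ?_⟩
  rw [wNorm_sq (H.isJet (hpos t ht)).pos]
  exact le_of_deriv_add_le hd hle ht

/-- All derivatives of the curvature stay bounded. -/
lemma exists_abs_jetAt_le (H : IsElasticMotion μ g V W) (hμ : 0 < μ) :
    ∃ S : ℕ → ℝ, ∀ j t x, 1 ≤ t → |jetAt g t j x| ≤ S j := by
  obtain ⟨K, L, M, hK, hL, hb⟩ := H.exists_basic_bounds hμ
  choose C hC using H.exists_wNorm_le hμ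
  refine ⟨fun j => √(C j ^ 2 / L + 2 * (C j * C (j + 1))), fun j t x ht => Real.abs_le_sqrt ?_⟩
  have hJ := H.isJet (zero_lt_one.trans_le ht)
  have h1 := sq_mul_length_le hJ.cont hJ.pos (hJ.continuous (j + 1)) (hJ.hasDerivAt j)
    (hJ.periodic j) x
  obtain ⟨-, hLv, -⟩ := hb t ht
  set ℓ := wInt (speedAt g t) fun _ => 1
  have hℓ : 0 < ℓ := hL.trans_le hLv
  have h2 : wNorm (speedAt g t) (jetAt g t j) ^ 2 ≤ C j ^ 2 :=
    pow_le_pow_left₀ wNorm_nonneg (hC j t ht) 2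
  have h3 : wNorm (speedAt g t) (jetAt g t j) * wNorm (speedAt g t) (jetAt g t (j + 1))
      ≤ C j * C (j + 1) := mul_le_mul (hC j t ht) (hC _ t ht) wNorm_nonneg
        (wNorm_nonneg.trans (hC j t ht))
  have h4 : C j ^ 2 ≤ C j ^ 2 / L * ℓ := by
    rw [div_mul_eq_mul_div, le_div_iff₀ hL]
    exact mul_le_mul_of_nonneg_left hLv (sq_nonneg _)
  refine le_of_mul_le_mul_right (h1.trans ?_) hℓ
  nlinarith

lemma exists_abs_ev_le (H : IsElasticMotion μ g V W) (hμ : 0 < μ) (P : DiffPoly) :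
    ∃ C, ∀ t x, 1 ≤ t → |ev (jetAt g t) P x| ≤ C := by
  obtain ⟨S, hS⟩ := H.exists_abs_jetAt_le hμ
  obtain ⟨C, hC⟩ := exists_bound P S
  exact ⟨C, fun t x ht => hC _ x fun j => hS j t x ht⟩

/-- Otherwise the energy would decrease at rate at least `ε ^ 2` from some time on and become
negative. -/
lemma exists_time_wNorm_vel_le (H : IsElasticMotion μ g V W) (hμ : 0 < μ) {ε : ℝ} (hε : 0 < ε)
    (T : ℝ) : ∃ t, 1 ≤ t ∧ T ≤ t ∧ wNorm (speedAt g t) (ev (jetAt g t) (vel μ)) ≤ ε := by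
  by_contra! hcon
  set T' := max 1 T
  set y : ℝ → ℝ := fun t => energyAt μ g t + ε ^ 2 * t with hy
  have h1 : ∀ s, T' ≤ s → (1 : ℝ) ≤ s := fun s hs => (le_max_left _ _).trans hs
  have hd : ∀ s, T' ≤ s → HasDerivAt y
      (- wNorm (speedAt g s) (ev (jetAt g s) (vel μ)) ^ 2 + ε ^ 2 * 1) s := fun s hs =>
    (H.hasDerivAt_energyAt (zero_lt_one.trans_le (h1 s hs))).add
      ((hasDerivAt_id s).const_mul (ε ^ 2))
  have hanti : AntitoneOn y (Set.Ici T') := by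
    refine antitoneOn_of_deriv_nonpos (convex_Ici T')
      (fun s hs => (hd s hs).continuousAt.continuousWithinAt)
      (fun s hs => (hd s (interior_subset hs)).differentiableAt.differentiableWithinAt)
      (fun s hs => ?_)
    have hs1 : T' ≤ s := interior_subset hs
    rw [(hd s hs1).deriv]
    have := hcon s (h1 s hs1) ((le_max_right _ _).trans hs1)
    nlinarith
  have hnn : ∀ s, T' ≤ s → 0 ≤ energyAt μ g s := fun s hs =>
    add_nonneg (sq_nonneg _) (mul_nonneg hμ.le
      (wInt_nonneg (H.isJet (zero_lt_one.trans_le (h1 s hs))).pos fun _ => zero_le_one))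
  have hT' : 0 ≤ energyAt μ g T' := hnn T' le_rfl
  -- At this time the energy would be at most `-1`.
  set s := T' + (energyAt μ g T' + 1) / ε ^ 2 with hs
  have hs1 : T' ≤ s := by
    have : 0 ≤ (energyAt μ g T' + 1) / ε ^ 2 := by positivity
    rw [hs]; linarith
  have h2 : y s ≤ y T' := hanti (Set.mem_Ici.2 le_rfl) hs1 hs1
  have h3 : ε ^ 2 * s = ε ^ 2 * T' + (energyAt μ g T' + 1) := by rw [hs]; field_simp
  have h4 := hnn s hs1
  simp only [hy] at h2
  linarith

/-- There are arbitrarily late times at which the normal velocity is uniformly small. -/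
lemma exists_time_vel_le (H : IsElasticMotion μ g V W) (hμ : 0 < μ) {ε : ℝ} (hε : 0 < ε)
    (T : ℝ) : ∃ t, 1 ≤ t ∧ T ≤ t ∧ ∀ x, |ev (jetAt g t) (vel μ) x| ≤ ε := by
  obtain ⟨K, L, M, hK, hL, hb⟩ := H.exists_basic_bounds hμ
  obtain ⟨C, hC⟩ := H.exists_abs_ev_le hμ (D (vel μ))
  have hC0 : 0 ≤ C := (abs_nonneg _).trans (hC 1 0 le_rfl)
  have hM0 : 0 ≤ M := hL.le.trans ((hb 1 le_rfl).2.1.trans (hb 1 le_rfl).2.2)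
  -- The Sobolev inequality gives `V² ≤ N² / ℓ + 2 N ‖∂ₛ V‖ ≤ N A`, where `N = ‖V‖ ≤ 1` is used to
  -- replace `N²` by `N`.
  set A := 1 / L + 2 * (C * √M) with hA
  have hA0 : 0 < A := by positivity
  obtain ⟨t, ht1, htT, hV⟩ := H.exists_time_wNorm_vel_le hμ
    (ε := min 1 (ε ^ 2 / A)) (by positivity) T
  refine ⟨t, ht1, htT, fun x => abs_le_of_sq_le_sq ?_ hε.le⟩
  have hJ := H.isJet (zero_lt_one.trans_le ht1)
  have h1 := sq_mul_length_le hJ.cont hJ.pos (continuous_ev hJ (D (vel μ)))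
    (hasDerivAt_ev hJ (vel μ)) (periodic_ev hJ (vel μ)) x
  obtain ⟨-, hLv, hMv⟩ := hb t ht1
  have h2 : wNorm (speedAt g t) (ev (jetAt g t) (D (vel μ))) ≤ C * √M := by
    refine (le_abs_self _).trans (abs_le_of_sq_le_sq ?_ (by positivity))
    rw [mul_pow, Real.sq_sqrt hM0]
    exact (wNorm_le_of_abs_le hJ.cont hJ.pos (continuous_ev hJ _) fun x => hC t x ht1).trans
      (by gcongr)
  set ℓ := wInt (speedAt g t) fun _ => 1
  have hℓ : 0 < ℓ := hL.trans_le hLv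
  set N := wNorm (speedAt g t) (ev (jetAt g t) (vel μ)) with hN
  have hN0 : 0 ≤ N := wNorm_nonneg
  have hN1 : N ≤ 1 := hV.trans (min_le_left _ _)
  have hN2 : N * A ≤ ε ^ 2 := (le_div_iff₀ hA0).1 (hV.trans (min_le_right _ _))
  refine (le_of_mul_le_mul_right (h1.trans ?_) hℓ).trans hN2
  have h3 : N ^ 2 ≤ N * (1 / L) * ℓ := by
    have : 1 ≤ 1 / L * ℓ := by rw [one_div_mul_eq_div, le_div_iff₀ hL]; linarith
    nlinarith
  have h4 : N * wNorm (speedAt g t) (ev (jetAt g t) (D (vel μ))) ≤ N * (C * √M) := by gcongr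
  rw [hA]
  nlinarith

end IsElasticMotion

end Bounds

/-! ### Reparametrization by constant speed -/

/-- `φ` is the inverse of the normalized arclength `s x = ℓ⁻¹ ∫₀ˣ v`, which commutes with the unit
translation because `v` is periodic. -/
lemma exists_reparametrization {v : ℝ → ℝ} (hv : ContDiff ℝ ∞ v) (hpos : ∀ x, 0 < v x)
    (hper : Function.Periodic v 1) : ∃ φ : ℝ → ℝ, IsReparametrization φ ∧
      ∀ x, HasDerivAt φ (wInt v (fun _ => 1) / v (φ x)) x := by
  have hvc := hv.continuous
  set ℓ := wInt v fun _ => 1 with hℓ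
  have hℓe : ℓ = ∫ x in (0 : ℝ)..1, v x := by simp [hℓ, wInt]
  have hℓpos : 0 < ℓ := by
    rw [hℓe]
    exact intervalIntegral.intervalIntegral_pos_of_pos (hvc.intervalIntegrable _ _) hpos zero_lt_one
  set s : ℝ → ℝ := fun x => (∫ y in (0 : ℝ)..x, v y) / ℓ with hs
  have hsd : ∀ x, HasDerivAt s (v x / ℓ) x := fun x =>
    (hvc.integral_hasStrictDerivAt 0 x).hasDerivAt.div_const ℓ
  have hsd0 : ∀ x, 0 < v x / ℓ := fun x => div_pos (hpos x) hℓpos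
  have hssm : ContDiff ℝ ∞ s := by
    rw [contDiff_infty_iff_deriv]
    refine ⟨fun x => (hsd x).differentiableAt, ?_⟩
    rw [show deriv s = fun x => v x / ℓ from funext fun x => (hsd x).deriv]
    exact hv.div_const ℓ
  have hmono : StrictMono s := strictMono_of_hasDerivAt_pos hsd hsd0
  have hs1 : ∀ x, s (x + 1) = s x + 1 := fun x => by
    simp only [hs]
    rw [← intervalIntegral.integral_add_adjacent_intervals (b := x)
      (hvc.intervalIntegrable _ _) (hvc.intervalIntegrable _ _), add_div,
      hper.intervalIntegral_add_eq x 0, zero_add, ← hℓe, div_self hℓpos.ne']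
  have hs0 : s 0 = 0 := by simp [hs]
  -- The intermediate value theorem on one period reaches the fractional part of `y`; translation by
  -- the integer part does the rest.
  have hsurj : Function.Surjective s := fun y => by
    have hp : Function.Periodic (fun x => s x - x) 1 := fun x => by simp only [hs1]; ring
    have hcs : ContinuousOn s (Set.Icc 0 1) := hssm.continuous.continuousOn
    have h1 : s 1 = 1 := by simpa [hs0] using hs1 0
    obtain ⟨x, -, hx⟩ := intermediate_value_Icc zero_le_one hcs
      (show Int.fract y ∈ Set.Icc (s 0) (s 1) by
        rw [hs0, h1]; exact ⟨Int.fract_nonneg y, (Int.fract_lt_one y).le⟩)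
    refine ⟨x + ⌊y⌋, ?_⟩
    have h2 := hp.int_mul ⌊y⌋ x
    simp only [mul_one] at h2
    have := Int.fract_add_floor y
    linarith
  set e : ℝ ≃ₜ ℝ := (StrictMono.orderIsoOfSurjective s hmono hsurj).toHomeomorph with he
  have hes : ∀ x, e x = s x := fun x => rfl
  have hse : ∀ y, s (e.symm y) = y := fun y => e.apply_symm_apply y
  have hed : ∀ x, HasDerivAt e (v x / ℓ) x := hsd
  have hφd : ∀ x, HasDerivAt e.symm (ℓ / v (e.symm x)) x := fun x => by
    have := HasDerivAt.of_local_left_inverse e.symm.continuous.continuousAt (hed (e.symm x))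
      (hsd0 _).ne' (Filter.Eventually.of_forall hse)
    rwa [inv_div] at this
  refine ⟨e.symm, ⟨e.contDiff_symm_deriv (fun x => (hsd0 x).ne') hed hssm, fun x => ?_,
    fun x => hmono.injective ?_⟩, hφd⟩
  · rw [(hφd x).deriv]; exact div_pos hℓpos (hpos _)
  · rw [hse, hs1, hse]

/-! ### Derivatives of the constant speed parametrization in the moving frame -/

section Frame

open DiffPoly MvPolynomial

variable {μ : ℝ} {g : ℝ × ℝ → Plane} {V W : ℝ × ℝ → ℝ} {t : ℝ} {φ : ℝ → ℝ}

/-- The vector field with tangential and normal components given by differential polynomials in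
the curvature. -/
def frameField (g : ℝ × ℝ → Plane) (P : DiffPoly × DiffPoly) (p : ℝ × ℝ) : Plane :=
  evAt g P.1 p • tau g p + evAt g P.2 p • nu g p

/-- The arclength derivative of vector fields in terms of components. -/
def frameD (P : DiffPoly × DiffPoly) : DiffPoly × DiffPoly :=
  (D P.1 - P.2 * X 0, D P.2 + P.1 * X 0)

namespace IsMotion

lemma smooth_frameField (H : IsMotion g V W) (P : DiffPoly × DiffPoly) :
    SmoothPos (frameField g P) := fun p hp =>
  ((H.smooth_evAt P.1 p hp).smul (H.smooth_tau p hp)).add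
    ((H.smooth_evAt P.2 p hp).smul (H.smooth_nu p hp))

/-- The Frenet equations `∂ₛ τ = k ν` and `∂ₛ ν = -k τ`. -/
lemma dS_frameField (H : IsMotion g V W) (P : DiffPoly × DiffPoly) {p : ℝ × ℝ} (hp : 0 < p.1) :
    dS g (frameField g P) p = frameField g (frameD P) p := by
  have h1 : dS g (frameField g P) p = dS g (fun q => evAt g P.1 q • tau g q) p
      + dS g (fun q => evAt g P.2 q • nu g q) p := by
    simp only [dS_eq_fderiv]
    change fderiv ℝ (fun q => evAt g P.1 q • tau g q + evAt g P.2 q • nu g q) p _ = _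
    rw [fderiv_fun_add]
    · rfl
    · exact ((H.smooth_evAt P.1).differentiableAt hp).smul (H.smooth_tau.differentiableAt hp)
    · exact ((H.smooth_evAt P.2).differentiableAt hp).smul (H.smooth_nu.differentiableAt hp)
  have h2 : ∀ P Q : DiffPoly, evAt g (P + Q * X 0) p = evAt g P p + evAt g Q p * kap g p := by
    intro P Q; simp [evAt, ev, jetAt, kapD]
  have h3 : ∀ P Q : DiffPoly, evAt g (P - Q * X 0) p = evAt g P p - evAt g Q p * kap g p := by
    intro P Q; simp [evAt, ev, jetAt, kapD]
  rw [h1, dS_smul (H.smooth_evAt _) H.smooth_tau hp, dS_smul (H.smooth_evAt _) H.smooth_nu hp,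
    H.dS_tau hp, H.dS_nu hp, H.dS_evAt _ hp, H.dS_evAt _ hp, frameField, frameD, h2, h3]
  module

lemma norm_frameField_le (H : IsMotion g V W) (P : DiffPoly × DiffPoly) {p : ℝ × ℝ}
    (hp : 0 < p.1) : ‖frameField g P p‖ ≤ |evAt g P.1 p| + |evAt g P.2 p| := by
  have h1 : ‖tau g p‖ = 1 := by
    have := H.inner_tau_tau hp
    rw [real_inner_self_eq_norm_sq] at this
    exact (pow_eq_one_iff_of_nonneg (norm_nonneg _) two_ne_zero).1 this
  have h2 : ‖nu g p‖ = 1 := by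
    have := H.inner_tau_tau hp
    rw [← inner_rot_rot, real_inner_self_eq_norm_sq] at this
    exact (pow_eq_one_iff_of_nonneg (norm_nonneg _) two_ne_zero).1 this
  refine (norm_add_le _ _).trans ?_
  rw [norm_smul, norm_smul, h1, h2, mul_one, mul_one, Real.norm_eq_abs, Real.norm_eq_abs]

/-- The length at time `t`. -/
def _root_.ElasticFlow.lengthAt (g : ℝ × ℝ → Plane) (t : ℝ) : ℝ := wInt (speedAt g t) fun _ => 1

lemma hasDerivAt_comp_reparam (H : IsMotion g V W) (ht : 0 < t)
    (hφ : ∀ x, HasDerivAt φ (lengthAt g t / speedAt g t (φ x)) x) {F : Type*}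
    [NormedAddCommGroup F] [NormedSpace ℝ F] {f : ℝ × ℝ → F} (hf : SmoothPos f) (x : ℝ) :
    HasDerivAt (fun x => f (t, φ x)) (lengthAt g t • dS g f (t, φ x)) x := by
  have h1 := (H.hasDerivAt_space hf ht (φ x)).scomp x (hφ x)
  refine h1.congr_deriv ?_
  have h2 : speedAt g t (φ x) ≠ 0 := ((H.isJet ht).pos _).ne'
  rw [smul_smul]
  congr 1
  exact div_mul_cancel₀ _ h2

lemma hasDerivAt_frameField (H : IsMotion g V W) (ht : 0 < t)
    (hφ : ∀ x, HasDerivAt φ (lengthAt g t / speedAt g t (φ x)) x) (P : DiffPoly × DiffPoly)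
    (x : ℝ) : HasDerivAt (fun x => frameField g P (t, φ x))
      (lengthAt g t • frameField g (frameD P) (t, φ x)) x := by
  have := H.hasDerivAt_comp_reparam ht hφ (H.smooth_frameField P) x
  rwa [H.dS_frameField _ (p := (t, φ x)) ht] at this

/-- In constant speed parametrization `∂ₓ = ℓ ∂ₛ`, and `ℓ` does not depend on `x`. Every derivative
of positive order is thus a power of the length times a universal expression in the curvature and
the frame, starting from `τ`, whose components are `(1, 0)`. -/
lemma iteratedDeriv_reparam (H : IsMotion g V W) (ht : 0 < t)
    (hφ : ∀ x, HasDerivAt φ (lengthAt g t / speedAt g t (φ x)) x) (b : Plane) (m : ℕ) :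
    iteratedDeriv (m + 1) (fun x => g (t, φ x) - b)
      = fun x => lengthAt g t ^ (m + 1) • frameField g (frameD^[m] (1, 0)) (t, φ x) := by
  induction m with
  | zero =>
    ext1 x
    rw [zero_add, iteratedDeriv_one,
      ((H.hasDerivAt_comp_reparam ht hφ H.smooth x).sub_const b).deriv, pow_one]
    simp [frameField, evAt, ev, tau]
  | succ m ih =>
    ext1 x
    have h1 := (H.hasDerivAt_frameField ht hφ (frameD^[m] (1, 0)) x).const_smul
      (lengthAt g t ^ (m + 1))
    rw [iteratedDeriv_succ, ih, Function.iterate_succ_apply', pow_succ _ (m + 1), mul_smul]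
    exact h1.deriv

end IsMotion

end Frame

/-! ### Compactness -/

lemma iteratedDeriv_periodic {E : Type*} [NormedAddCommGroup E] [NormedSpace ℝ E] {f : ℝ → E}
    (hf : Function.Periodic f 1) (m : ℕ) : Function.Periodic (iteratedDeriv m f) 1 := fun x => by
  have h1 : (fun z => f (z + 1)) = f := funext hf
  have h2 := iteratedDeriv_comp_add_const m f 1
  rw [h1] at h2
  exact (congrFun h2 x).symm

/-- Bounds on all derivatives imply smooth convergence of a subsequence. -/
lemma exists_smooth_limit {c : ℕ → ℝ → Plane} (hc : ∀ i, ContDiff ℝ ∞ (c i))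
    (hp : ∀ i, Function.Periodic (c i) 1)
    (hb : ∀ m, ∃ C, ∀ i x, ‖iteratedDeriv m (c i) x‖ ≤ C) :
    ∃ (σ : ℕ → ℕ) (cLim : ℝ → Plane), StrictMono σ ∧ ContDiff ℝ ∞ cLim ∧
      Function.Periodic cLim 1 ∧ SmoothlyConverges (fun i => c (σ i)) cLim := by
  choose C hC using hb
  have hd : ∀ i m x, HasDerivAt (iteratedDeriv m (c i)) (iteratedDeriv (m + 1) (c i) x) x := by
    intro i m x
    rw [iteratedDeriv_succ]
    exact (((hc i).differentiable_iteratedDeriv m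
      (by exact_mod_cast WithTop.coe_lt_top m)) x).hasDerivAt
  let X := Set.Icc (0 : ℝ) 1
  have hcont : ∀ i m, Continuous (iteratedDeriv m (c i)) := fun i m =>
    continuous_iff_continuousAt.2 fun x => (hd i m x).continuousAt
  let u : ℕ → ℕ → BoundedContinuousFunction X Plane := fun i m =>
    BoundedContinuousFunction.mkOfCompact ⟨fun x => iteratedDeriv m (c i) x, by
      exact (hcont i m).comp continuous_subtype_val⟩
  have hlip : ∀ i m, LipschitzWith (Real.toNNReal (C (m + 1))) (u i m) := fun i m => by
    have h1 : LipschitzWith (Real.toNNReal (C (m + 1))) (iteratedDeriv m (c i)) :=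
      lipschitzWith_of_nnnorm_deriv_le (fun x => (hd i m x).differentiableAt) fun x => by
        rw [(hd i m x).deriv, ← NNReal.coe_le_coe, coe_nnnorm]
        exact (hC (m + 1) i x).trans (Real.le_coe_toNNReal _)
    exact LipschitzWith.of_dist_le_mul fun x y => h1.dist_le_mul x y
  have hcomp : ∀ m, IsCompact (closure (Set.range fun i => u i m)) := fun m => by
    refine BoundedContinuousFunction.arzela_ascoli (Metric.closedBall 0 (C m))
      (isCompact_closedBall 0 (C m)) _ ?_ ?_
    · rintro _ x ⟨i, rfl⟩
      rw [mem_closedBall_zero_iff]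
      exact hC m i x
    · refine (LipschitzWith.uniformEquicontinuous _ (Real.toNNReal (C (m + 1))) ?_).equicontinuous
      rintro ⟨_, i, rfl⟩
      exact hlip i m
  -- The product over all orders `m` of the compact closures is compact, so a single subsequence
  -- converges in every order at once.
  obtain ⟨w, -, σ, hσ, hw⟩ := (isCompact_univ_pi hcomp).tendsto_subseq (x := u)
    fun i m _ => subset_closure ⟨i, rfl⟩
  have hfr : ∀ x : ℝ, Int.fract x ∈ X := fun x => ⟨Int.fract_nonneg x, (Int.fract_lt_one x).le⟩
  let G : ℕ → ℝ → Plane := fun m x => w m ⟨Int.fract x, hfr x⟩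
  have hunif : ∀ m, TendstoUniformly (fun i => iteratedDeriv m (c (σ i))) (G m) Filter.atTop := by
    intro m
    have h1 := (BoundedContinuousFunction.tendsto_iff_tendstoUniformly).1
      ((tendsto_pi_nhds.1 hw) m)
    have h2 := h1.comp fun x : ℝ => (⟨Int.fract x, hfr x⟩ : X)
    intro U hU
    filter_upwards [h2 U hU] with i hi x
    have h3 := (iteratedDeriv_periodic (hp (σ i)) m).sub_int_mul_eq ⌊x⌋ (x := x)
    rw [mul_one] at h3
    rw [← h3]
    exact hi x
  -- Uniform convergence of the next derivatives makes the limits successive derivatives of `G 0`.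
  have hG : ∀ m x, HasDerivAt (G m) (G (m + 1) x) x := fun m =>
    hasDerivAt_of_tendstoUniformly (hunif (m + 1))
      (Filter.Eventually.of_forall fun i x => hd (σ i) m x)
      fun x => (hunif m).tendsto_at x
  have hGm : ∀ m, iteratedDeriv m (G 0) = G m := by
    intro m
    induction m with
    | zero => exact iteratedDeriv_zero
    | succ m ih => ext1 x; rw [iteratedDeriv_succ, ih, (hG m x).deriv]
  refine ⟨σ, G 0, hσ, contDiff_of_differentiable_iteratedDeriv fun m _ x => ?_, fun x => ?_,
    fun m => ?_⟩
  · rw [hGm]; exact (hG m x).differentiableAt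
  · simp only [G, Int.fract_add_one]
  · rw [hGm]; exact hunif m

/-! ### A criterion for elasticae -/

/-- Differentiating the factor `‖c'‖⁻¹` of the tangent yields only a multiple of `c'`, which the
normal annihilates; its value is therefore never needed. -/
lemma curvature_eq {c : ℝ → Plane} {x : ℝ} {q : Plane} (hq : HasDerivAt (deriv c) q x)
    (h0 : deriv c x ≠ 0) :
    curvature c x = inner ℝ q (rot (deriv c x)) / ‖deriv c x‖ ^ 3 := by
  have hn : ‖deriv c x‖ ≠ 0 := norm_ne_zero_iff.2 h0
  have h1 : HasDerivAt (fun y => ‖deriv c y‖⁻¹) (deriv (fun y => ‖deriv c y‖⁻¹) x) x :=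
    ((hq.differentiableAt.norm ℝ h0).inv hn).hasDerivAt
  have h2 : HasDerivAt (tangent c) _ x := h1.smul hq
  have h3 : normal c x = ‖deriv c x‖⁻¹ • rot (deriv c x) := by
    rw [← map_smul]; rfl
  rw [curvature, h3, arcDeriv, h2.deriv]
  simp only [inner_smul_left, inner_smul_right, inner_add_left, inner_self_rot]
  simp
  field_simp

/-- The integrand of the first variation of the elastic energy at a curve of constant speed. -/
lemma first_variation_identity {μ ℓ : ℝ} {p q a b : Plane} (hℓ : 0 < ℓ) (hp : ‖p‖ = ℓ)
    (hpq : inner ℝ p q = (0 : ℝ)) :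
    (2 * inner ℝ q (rot p) * (inner ℝ q (rot a) + inner ℝ b (rot p)) * ℓ ^ 5
        - inner ℝ q (rot p) ^ 2 * (5 * ℓ ^ 4 * (inner ℝ p a / ℓ))) / (ℓ ^ 5) ^ 2
      + μ * (inner ℝ p a / ℓ)
      = 2 / ℓ ^ 3 * inner ℝ q b + (μ - 3 * (‖q‖ ^ 2 / ℓ ^ 4)) / ℓ * inner ℝ p a := by
  set κ : ℝ := inner ℝ q (rot p) with hκ
  -- Constant speed makes `q` orthogonal to `p`, hence a multiple of `rot p`; all products with `κ`
  -- then reduce to `⟨q, b⟩`, `⟨p, a⟩` and `‖q‖²`.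
  have hqr : ℓ ^ 2 • q = κ • rot p := by
    have he : inner ℝ (ℓ⁻¹ • p) (ℓ⁻¹ • p) = (1 : ℝ) := by
      rw [real_inner_smul_left, real_inner_smul_right, real_inner_self_eq_norm_sq, hp]
      field_simp
    have h1 := eq_smul_rot_of_inner_eq_zero (u := q) he (by
      rw [real_inner_smul_right, real_inner_comm, hpq, mul_zero])
    rw [map_smul, real_inner_smul_right, smul_smul] at h1
    nth_rw 1 [h1]
    rw [smul_smul]
    congr 1
    field_simp
    exact hκ.symm
  have hκ1 : κ * inner ℝ b (rot p) = ℓ ^ 2 * inner ℝ q b := by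
    rw [← real_inner_smul_right, ← hqr, real_inner_smul_right, real_inner_comm]
  have hκ2 : ℓ ^ 2 * inner ℝ q (rot a) = κ * inner ℝ p a := by
    rw [← real_inner_smul_left, hqr, real_inner_smul_left, inner_rot_rot]
  have hκ3 : κ ^ 2 = ℓ ^ 2 * ‖q‖ ^ 2 := by
    have h1 : inner ℝ (ℓ ^ 2 • q) (ℓ ^ 2 • q) = inner ℝ (κ • rot p) (κ • rot p) := by rw [hqr]
    rw [real_inner_smul_left, real_inner_smul_right, real_inner_smul_left, real_inner_smul_right,
      inner_rot_rot, real_inner_self_eq_norm_sq, real_inner_self_eq_norm_sq, hp] at h1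
    have : ℓ ^ 2 * (κ ^ 2) = ℓ ^ 2 * (ℓ ^ 2 * ‖q‖ ^ 2) := by linarith
    exact mul_left_cancel₀ (by positivity) this
  set κ' := inner ℝ q (rot a) + inner ℝ b (rot p) with hκ'
  have hκκ : ℓ ^ 2 * (κ * κ') = ℓ ^ 2 * (‖q‖ ^ 2 * inner ℝ p a + ℓ ^ 2 * inner ℝ q b) := by
    rw [hκ']
    linear_combination κ * hκ2 + ℓ ^ 2 * hκ1 + inner ℝ p a * hκ3
  have hκκ' := mul_left_cancel₀ (by positivity) hκκ
  rw [mul_assoc 2, hκκ', hκ3]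
  field_simp
  ring

/-- The first variation of the elastic energy at a curve of constant speed. -/
lemma hasDerivAt_elasticEnergy {μ ℓ : ℝ} {c p q ψ a b : ℝ → Plane} (hℓ : 0 < ℓ)
    (hpn : ∀ x, ‖p x‖ = ℓ) (hcd0 : ∀ x, HasDerivAt c (p x) x) (hpd : ∀ x, HasDerivAt p (q x) x)
    (hqc : Continuous q) (hψ1 : ∀ x, HasDerivAt ψ (a x) x) (hψ2 : ∀ x, HasDerivAt a (b x) x)
    (hψ2c : Continuous b) (hap : Function.Periodic a 1) :
    HasDerivAt (fun ε : ℝ => elasticEnergy μ fun x => c x + ε • ψ x)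
      ((∫ x in (0 : ℝ)..1, (2 * inner ℝ (q x) (rot (p x))
          * (inner ℝ (q x) (rot (a x)) + inner ℝ (b x) (rot (p x))) * ℓ ^ 5
        - inner ℝ (q x) (rot (p x)) ^ 2 * (5 * ℓ ^ 4 * (inner ℝ (p x) (a x) / ℓ))) / (ℓ ^ 5) ^ 2)
      + μ * ∫ x in (0 : ℝ)..1, inner ℝ (p x) (a x) / ℓ) 0 := by
  have hpc : Continuous p := continuous_iff_continuousAt.2 fun x => (hpd x).continuousAt
  have hac : Continuous a := continuous_iff_continuousAt.2 fun x => (hψ2 x).continuousAt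
  obtain ⟨A, hA⟩ := (isCompact_Icc (a := (0 : ℝ)) (b := 1)).exists_bound_of_continuousOn
    hac.continuousOn
  have hA' : ∀ x, ‖a x‖ ≤ A := fun x => by
    obtain ⟨y, hy, hyx⟩ := exists_mem_Icc_of_periodic
      (f := fun x => ‖a x‖) (fun x => by simp only [hap x]) x
    rw [← hyx]; exact hA y hy
  have hA0 : 0 ≤ A := (norm_nonneg _).trans (hA' 0)
  -- For `|ε| < δ` the perturbation `ε • a` is shorter than `p`, so the varied curve stays regular.
  set δ := ℓ / (A + 1) with hδ
  have hδ0 : 0 < δ := by positivity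
  have hne : ∀ ε ∈ Metric.ball (0 : ℝ) δ, ∀ x, p x + ε • a x ≠ 0 := fun ε hε x h => by
    rw [mem_ball_zero_iff, Real.norm_eq_abs, hδ, lt_div_iff₀ (by positivity)] at hε
    have h1 : ‖p x‖ = |ε| * ‖a x‖ := by
      rw [eq_neg_of_add_eq_zero_left h, norm_neg, norm_smul, Real.norm_eq_abs]
    rw [hpn] at h1
    nlinarith [hA' x, abs_nonneg ε]
  set n : ℝ → ℝ → ℝ := fun ε x => ‖p x + ε • a x‖ with hn
  set κ : ℝ → ℝ → ℝ := fun ε x => inner ℝ (q x + ε • b x) (rot (p x + ε • a x)) with hκ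
  set n' : ℝ → ℝ → ℝ := fun ε x => inner ℝ (p x + ε • a x) (a x) / n ε x with hn'
  set κ' : ℝ → ℝ → ℝ := fun ε x => inner ℝ (q x + ε • b x) (rot (a x))
    + inner ℝ (b x) (rot (p x + ε • a x)) with hκ'
  have hn0 : ∀ ε ∈ Metric.ball (0 : ℝ) δ, ∀ x, 0 < n ε x := fun ε hε x =>
    norm_pos_iff.2 (hne ε hε x)
  have hlin : ∀ (u w : Plane) (ε : ℝ), HasDerivAt (fun ε : ℝ => u + ε • w) w ε := fun u w ε => by
    simpa using ((hasDerivAt_id ε).smul_const w).const_add u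
  have hnd : ∀ ε ∈ Metric.ball (0 : ℝ) δ, ∀ x, HasDerivAt (fun ε => n ε x) (n' ε x) ε :=
    fun ε hε x => by
      have h1 := ((hlin (p x) (a x) ε).norm_sq).sqrt (by
        have := hn0 ε hε x; positivity)
      have h2 : (fun ε : ℝ => √(‖p x + ε • a x‖ ^ 2)) = fun ε => n ε x := by
        ext ε; exact Real.sqrt_sq (norm_nonneg _)
      rw [h2, Real.sqrt_sq (norm_nonneg _)] at h1
      refine h1.congr_deriv ?_
      rw [hn', mul_div_mul_left _ _ two_ne_zero]
  have hκd : ∀ ε x, HasDerivAt (fun ε => κ ε x) (κ' ε x) ε := fun ε x =>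
    (hlin (q x) (b x) ε).inner ℝ (rot.hasFDerivAt.comp_hasDerivAt ε (hlin (p x) (a x) ε))
  have hnc : Continuous (Function.uncurry n) := by
    simp only [hn, Function.uncurry_def]; fun_prop
  have hκc : Continuous (Function.uncurry κ) := by
    simp only [hκ, Function.uncurry_def]; fun_prop
  have hκc' : Continuous (Function.uncurry κ') := by
    simp only [hκ', Function.uncurry_def]; fun_prop
  have hnum : Continuous (fun z : ℝ × ℝ => inner ℝ (p z.2 + z.1 • a z.2) (a z.2)) := by
    fun_prop
  set S : Set (ℝ × ℝ) := Metric.ball (0 : ℝ) δ ×ˢ Set.univ with hS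
  have hnS : ∀ z ∈ S, Function.uncurry n z ≠ 0 := fun z hz => (hn0 z.1 hz.1 z.2).ne'
  have hnc' : ContinuousOn (Function.uncurry n') S :=
    hnum.continuousOn.div hnc.continuousOn hnS
  have h0 : (0 : ℝ) ∈ Metric.ball (0 : ℝ) δ := Metric.mem_ball_self hδ0
  -- With `k = κ / n³` and `ds = n dx`, the bending integrand is `κ² / n⁵`.
  have hc1 : ContinuousOn (fun z : ℝ × ℝ => κ z.1 z.2 ^ 2 / n z.1 z.2 ^ 5) S :=
    (hκc.continuousOn.pow 2).div (hnc.continuousOn.pow 5) fun z hz => pow_ne_zero _ (hnS z hz)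
  have hc2 : ContinuousOn (fun z : ℝ × ℝ => (2 * κ z.1 z.2 * κ' z.1 z.2 * n z.1 z.2 ^ 5
      - κ z.1 z.2 ^ 2 * (5 * n z.1 z.2 ^ 4 * n' z.1 z.2)) / (n z.1 z.2 ^ 5) ^ 2) S :=
    ((((continuousOn_const.mul hκc.continuousOn).mul hκc'.continuousOn).mul
      (hnc.continuousOn.pow 5)).sub ((hκc.continuousOn.pow 2).mul
      ((continuousOn_const.mul (hnc.continuousOn.pow 4)).mul hnc'))).div
      ((hnc.continuousOn.pow 5).pow 2) fun z hz => pow_ne_zero _ (pow_ne_zero _ (hnS z hz))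
  have hd1 := hasDerivAt_integral_of_continuousOn (F := fun ε x => κ ε x ^ 2 / n ε x ^ 5)
    (F' := fun ε x => (2 * κ ε x * κ' ε x * n ε x ^ 5 - κ ε x ^ 2 * (5 * n ε x ^ 4 * n' ε x))
      / (n ε x ^ 5) ^ 2) hδ0 hc1 hc2
    fun ε hε x => by
      have := ((hκd ε x).pow 2).div ((hnd ε hε x).pow 5) (pow_ne_zero _ (hn0 ε hε x).ne')
      refine this.congr_deriv ?_
      simp
  have hd2 := hasDerivAt_integral_of_continuousOn (F := n) (F' := n') hδ0 hnc.continuousOn hnc' hnd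
  have hE : ∀ ε ∈ Metric.ball (0 : ℝ) δ, elasticEnergy μ (fun x => c x + ε • ψ x)
      = (∫ x in (0 : ℝ)..1, κ ε x ^ 2 / n ε x ^ 5) + μ * ∫ x in (0 : ℝ)..1, n ε x := by
    intro ε hε
    have h1 : deriv (fun x => c x + ε • ψ x) = fun x => p x + ε • a x := funext fun x =>
      ((hcd0 x).add ((hψ1 x).const_smul ε)).deriv
    have h2 : ∀ x, HasDerivAt (deriv fun x => c x + ε • ψ x) (q x + ε • b x) x := fun x => by
      rw [h1]; exact (hpd x).add ((hψ2 x).const_smul ε)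
    have h3 : ∀ x, deriv (fun x => c x + ε • ψ x) x = p x + ε • a x := fun x => congrFun h1 x
    unfold elasticEnergy
    congr 1
    · congr 1
      ext x
      rw [curvature_eq (h2 x) (by rw [h3]; exact hne ε hε x), h3]
      have := (hn0 ε hε x).ne'
      change (κ ε x / n ε x ^ 3) ^ 2 * n ε x = _
      field_simp
    · simp only [h3, hn]
  have hd := hd1.add (hd2.const_mul μ)
  have e0 : ∀ x, n 0 x = ℓ := fun x => by simp [hn, hpn]
  simp only [hκ, hκ', hn', e0, zero_smul, add_zero] at hd
  refine hd.congr_of_eventuallyEq ?_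
  filter_upwards [Metric.ball_mem_nhds (0 : ℝ) hδ0] with ε hε
  exact hE ε hε

/-- A closed curve of constant speed is an elastica if the vector
`(μ - k²) τ - 2 (∂ₛ k) ν` is constant along the curve. -/
lemma isElastica_of_const {μ ℓ : ℝ} {c : ℝ → Plane} (hc : ContDiff ℝ ∞ c)
    (hper : Function.Periodic c 1) (hℓ : 0 < ℓ) (hspeed : ∀ x, ‖deriv c x‖ = ℓ) {J : Plane}
    (hJ : ∀ x, ((μ - 3 * (‖iteratedDeriv 2 c x‖ ^ 2 / ℓ ^ 4)) / ℓ) • iteratedDeriv 1 c x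
      - (2 / ℓ ^ 3) • iteratedDeriv 3 c x = J) : IsElastica μ c := by
  refine ⟨hc, hper, fun x => norm_pos_iff.1 (by rw [hspeed]; exact hℓ), fun ψ hψ hψp => ?_⟩
  have hcd : ∀ m x, HasDerivAt (iteratedDeriv m c) (iteratedDeriv (m + 1) c x) x := by
    intro m x
    rw [iteratedDeriv_succ]
    exact ((hc.differentiable_iteratedDeriv m
      (by exact_mod_cast WithTop.coe_lt_top m)) x).hasDerivAt
  set p := iteratedDeriv 1 c with hp
  set q := iteratedDeriv 2 c with hq
  have hcd0 : ∀ x, HasDerivAt c (p x) x := fun x => hcd 0 x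
  have hpd : ∀ x, HasDerivAt p (q x) x := hcd 1
  have hqd : ∀ x, HasDerivAt q (iteratedDeriv 3 c x) x := hcd 2
  have hψ1 : ∀ x, HasDerivAt ψ (deriv ψ x) x := fun x =>
    (hψ.differentiable (by simp) x).hasDerivAt
  have hψ1' : ContDiff ℝ 1 (deriv ψ) := by
    have : ContDiff ℝ (1 + 1) ψ := by simpa [one_add_one_eq_two] using hψ
    exact (contDiff_succ_iff_deriv.1 this).2.2
  have hψ2 : ∀ x, HasDerivAt (deriv ψ) (deriv (deriv ψ) x) x := fun x =>
    (hψ1'.differentiable (by simp) x).hasDerivAt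
  have hψ2c : Continuous (deriv (deriv ψ)) := hψ1'.continuous_deriv le_rfl
  set a := deriv ψ with ha
  set b := deriv a with hb
  have hac : Continuous a := hψ1'.continuous
  have hpc : Continuous p := continuous_iff_continuousAt.2 fun x => (hpd x).continuousAt
  have hqc : Continuous q := continuous_iff_continuousAt.2 fun x => (hqd x).continuousAt
  have hpn : ∀ x, ‖p x‖ = ℓ := fun x => by rw [hp, iteratedDeriv_one]; exact hspeed x
  have hap : Function.Periodic a 1 := by
    have := iteratedDeriv_periodic hψp 1
    rwa [iteratedDeriv_one] at this
  have hqp : Function.Periodic q 1 := iteratedDeriv_periodic hper 2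
  have hpq : ∀ x, inner ℝ (p x) (q x) = (0 : ℝ) := fun x => by
    have h1 : HasDerivAt (fun x => ‖p x‖ ^ 2) (2 * inner ℝ (p x) (q x)) x := (hpd x).norm_sq
    simp only [hpn] at h1
    have := h1.unique (hasDerivAt_const x _)
    linarith
  have hval := fun x => first_variation_identity (μ := μ) (a := a x) (b := b x) hℓ (hpn x) (hpq x)
  have hrpc : Continuous fun x => rot (p x) := rot.continuous.comp hpc
  have hrac : Continuous fun x => rot (a x) := rot.continuous.comp hac
  refine (hasDerivAt_elasticEnergy hℓ hpn hcd0 hpd hqc hψ1 hψ2 hψ2c hap).congr_deriv ?_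
  -- The first variation integrand has a periodic primitive: the third derivative of `c` produced by
  -- `⟨q, a⟩` cancels against the one contained in `J`.
  have hG : ∀ x, HasDerivAt (fun x => 2 / ℓ ^ 3 * inner ℝ (q x) (a x) + inner ℝ J (ψ x))
      (2 / ℓ ^ 3 * inner ℝ (q x) (b x)
        + (μ - 3 * (‖q x‖ ^ 2 / ℓ ^ 4)) / ℓ * inner ℝ (p x) (a x)) x := fun x => by
    have h1 := (((hqd x).inner ℝ (hψ2 x)).const_mul (2 / ℓ ^ 3)).add
      ((hasDerivAt_const x J).inner ℝ (hψ1 x))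
    refine h1.congr_deriv ?_
    rw [← hJ x, inner_sub_left, real_inner_smul_left, real_inner_smul_left, inner_zero_left]
    ring
  rw [← intervalIntegral.integral_const_mul, ← intervalIntegral.integral_add
    (Continuous.intervalIntegrable (by fun_prop) _ _)
    (Continuous.intervalIntegrable (by fun_prop) _ _)]
  simp only [hval]
  rw [intervalIntegral.integral_eq_sub_of_hasDerivAt (fun x _ => hG x)
    (Continuous.intervalIntegrable (by fun_prop) _ _)]
  have e1 : q 1 = q 0 := by simpa using hqp 0
  have e2 : a 1 = a 0 := by simpa using hap 0
  have e3 : ψ 1 = ψ 0 := by simpa using hψp 0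
  rw [e1, e2, e3, sub_self]

/-! ### Global solutions of the elastic flow -/

section Solution

open DiffPoly MvPolynomial

variable {μ α : ℝ} {γ₀ : ℝ → Plane} {γ : ℝ → ℝ → Plane} {t : ℝ}

/-- The map of time and space given by a moving curve. -/
def joint (γ : ℝ → ℝ → Plane) (p : ℝ × ℝ) : Plane := γ p.1 p.2

/-- The dictionary between the curve-by-curve notions of the statement and those for functions of
time and space. -/
lemma arcDeriv_slice {F : Type*} [NormedAddCommGroup F] [NormedSpace ℝ F] {f : ℝ × ℝ → F}
    (hγ : SmoothPos (joint γ)) (hf : SmoothPos f) (ht : 0 < t) :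
    arcDeriv (γ t) (fun x => f (t, x)) = fun x => dS (joint γ) f (t, x) := by
  ext1 x
  have h1 := hasDerivAt_slice_space (hγ.differentiableAt (p := (t, x)) ht)
  have h2 := hasDerivAt_slice_space (hf.differentiableAt (p := (t, x)) ht)
  have h3 : deriv (γ t) x = dX (joint γ) (t, x) := h1.deriv
  rw [arcDeriv, h3, h2.deriv]
  rfl

namespace IsGlobalSolution

lemma smoothPos (hγ : IsGlobalSolution μ α γ₀ γ) : SmoothPos (joint γ) := fun _ hp =>
  hγ.smooth.contDiffAt ((isOpen_Ioi.prod isOpen_univ).mem_nhds ⟨hp, trivial⟩)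

/-- A global solution is a motion by its normal and tangential velocities. -/
lemma isMotion (hγ : IsGlobalSolution μ α γ₀ γ) : IsMotion (joint γ)
    (fun p => inner ℝ (dT (joint γ) p) (nu (joint γ) p))
    (fun p => inner ℝ (dT (joint γ) p) (tau (joint γ) p)) := by
  set g := joint γ
  have hs : SmoothPos g := hγ.smoothPos
  have hreg : ∀ p : ℝ × ℝ, 0 < p.1 → dX g p ≠ 0 := fun p hp => by
    have h1 := (hasDerivAt_slice_space (hs.differentiableAt hp)).deriv
    rw [← h1]
    exact hγ.regular p.1 hp.le p.2
  have hper : PeriodicPos g := fun p hp => hγ.closed p.1 hp.le p.2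
  have htau : SmoothPos (tau g) := fun p hp =>
    (((hs.dX p hp).norm ℝ (hreg p hp)).inv (norm_ne_zero_iff.2 (hreg p hp))).smul (hs.dX p hp)
  have hnu : SmoothPos (nu g) := fun p hp => rot.contDiff.contDiffAt.comp p (htau p hp)
  refine ⟨hs, fun p hp => (hs.dT p hp).inner ℝ (hnu p hp),
    fun p hp => (hs.dT p hp).inner ℝ (htau p hp), hper, fun p hp => ?_, hreg, fun p hp => ?_⟩
  · have h1 := hper.fderiv_apply (0, 1) p hp
    have h2 := hper.fderiv_apply (1, 0) p hp
    simp only [dT, tau, dS, speed, dX] at h1 h2 ⊢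
    rw [h1, h2]
  · have he : inner ℝ (tau g p) (tau g p) = (1 : ℝ) := by
      have h0 : ‖dX g p‖ ≠ 0 := norm_ne_zero_iff.2 (hreg p hp)
      rw [tau, dS, real_inner_smul_left, real_inner_smul_right, real_inner_self_eq_norm_sq, speed]
      field_simp
    have h1 := eq_smul_rot_of_inner_eq_zero he
      (u := dT g p - (inner ℝ (dT g p) (tau g p) : ℝ) • tau g p) (by
        rw [inner_sub_left, real_inner_smul_left, he, mul_one, sub_self])
    rw [inner_sub_left, real_inner_smul_left, inner_self_rot, mul_zero, sub_zero] at h1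
    exact sub_eq_iff_eq_add.1 h1

lemma isElasticMotion (hγ : IsGlobalSolution μ α γ₀ γ) : IsElasticMotion μ (joint γ)
    (fun p => inner ℝ (dT (joint γ) p) (nu (joint γ) p))
    (fun p => inner ℝ (dT (joint γ) p) (tau (joint γ) p)) := by
  refine ⟨hγ.isMotion, ?_⟩
  rintro ⟨t, x⟩ (ht : 0 < t)
  have M := hγ.isMotion
  have hs := hγ.smoothPos
  have h1 : tangent (γ t) = fun x => tau (joint γ) (t, x) := arcDeriv_slice hs hs ht
  have h2 : normal (γ t) = fun x => nu (joint γ) (t, x) := by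
    ext1 x
    rw [nu, rot_apply]
    simp only [normal, h1]
  have h3 : curvature (γ t) = fun x => kapD (joint γ) 0 (t, x) := by
    ext1 x
    rw [curvature, h1, h2, arcDeriv_slice hs M.smooth_tau ht]
    rfl
  have h4 : timeDeriv γ t x = dT (joint γ) (t, x) := by
    rw [timeDeriv, derivWithin_of_mem_nhds (Ici_mem_nhds ht)]
    exact (hasDerivAt_slice_time (hs.differentiableAt (p := (t, x)) ht)).deriv
  have h5 := hγ.motion t ht.le x
  rw [h3, arcDeriv_slice hs (M.smooth_kapD 0) ht] at h5
  change _ = (-2 * arcDeriv (γ t) (fun x => kapD (joint γ) 1 (t, x)) x - _ + _) • _ at h5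
  rw [arcDeriv_slice hs (M.smooth_kapD 1) ht, h1, h2, h4] at h5
  have hn : inner ℝ (nu (joint γ) (t, x)) (nu (joint γ) (t, x)) = (1 : ℝ) := by
    rw [nu, inner_rot_rot]; exact M.inner_tau_tau (p := (t, x)) ht
  -- Pairing the flow equation with `ν` discards the tangential term and isolates the normal
  -- velocity.
  have h6 := congrArg (fun u => inner ℝ u (nu (joint γ) (t, x))) h5
  simp only [inner_sub_left, real_inner_smul_left, hn, mul_one] at h6
  rw [nu, inner_self_rot, mul_zero, sub_zero] at h6
  change inner ℝ (dT (joint γ) (t, x)) (rot (tau (joint γ) (t, x))) = _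
  rw [h6]
  simp [evAt, ev, vel, jetAt, kapD]

end IsGlobalSolution

end Solution

/-! ### Convergence -/

section Convergence

open DiffPoly MvPolynomial

variable {μ : ℝ} {g : ℝ × ℝ → Plane} {V W : ℝ × ℝ → ℝ} {t : ℝ} {φ : ℝ → ℝ}

/-- The components of the vector `(μ - k²) τ - 2 (∂ₛ k) ν`. -/
def forcePoly (μ : ℝ) : DiffPoly × DiffPoly := (C μ - X 0 * X 0, C (-2) * X 1)

/-- The conservation law `∂ₛ F = V ν`: the tangential parts `∓ 2 k ∂ₛk` cancel, and the normal part
is the velocity of the flow. Hence small `V` means that `F` is nearly constant. -/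
lemma frameD_forcePoly (μ : ℝ) : frameD (forcePoly μ) = (0, vel μ) := by
  have h0 : D (C μ) = 0 := Derivation.map_algebraMap D μ
  have h1 : D (C (-2) * X 1) = C (-2) * X 2 := by
    rw [← smul_eq_C_mul, Derivation.map_smul, D_X, smul_eq_C_mul]
  refine Prod.ext ?_ ?_
  · change D (C μ - X 0 * X 0) - C (-2) * X 1 * X 0 = 0
    rw [map_sub, h0, Derivation.leibniz, D_X, smul_eq_mul, map_neg, map_ofNat]
    ring
  · change D (C (-2) * X 1) + (C μ - X 0 * X 0) * X 0 = vel μ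
    rw [h1, vel]
    ring

/-- The force vector in terms of a constant speed parametrization. -/
lemma IsMotion.force_eq (H : IsMotion g V W) (ht : 0 < t) (hℓ : 0 < lengthAt g t)
    (hφ : ∀ x, HasDerivAt φ (lengthAt g t / speedAt g t (φ x)) x) (b : Plane) (x : ℝ) :
    ((μ - 3 * (‖iteratedDeriv 2 (fun x => g (t, φ x) - b) x‖ ^ 2 / lengthAt g t ^ 4))
        / lengthAt g t) • iteratedDeriv 1 (fun x => g (t, φ x) - b) x
      - (2 / lengthAt g t ^ 3) • iteratedDeriv 3 (fun x => g (t, φ x) - b) x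
      = frameField g (forcePoly μ) (t, φ x) := by
  have h1 := congrFun (H.iteratedDeriv_reparam ht hφ b 0) x
  have h2 := congrFun (H.iteratedDeriv_reparam ht hφ b 1) x
  have h3 := congrFun (H.iteratedDeriv_reparam ht hφ b 2) x
  simp only [Nat.reduceAdd] at h1 h2 h3
  have hD1 : D (1 : DiffPoly) = 0 := Derivation.map_one_eq_zero D
  have e1 : frameField g (frameD^[0] (1, 0)) (t, φ x) = tau g (t, φ x) := by
    simp [frameField, evAt, ev]
  have e2 : frameField g (frameD^[1] (1, 0)) (t, φ x) = kap g (t, φ x) • nu g (t, φ x) := by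
    simp [frameField, frameD, evAt, ev, hD1, jetAt, kapD]
  have e3 : frameField g (frameD^[2] (1, 0)) (t, φ x)
      = -(kap g (t, φ x) * kap g (t, φ x)) • tau g (t, φ x)
        + kapD g 1 (t, φ x) • nu g (t, φ x) := by
    simp [frameField, frameD, evAt, ev, hD1, jetAt, kapD]
  have e4 : frameField g (forcePoly μ) (t, φ x)
      = (μ - kap g (t, φ x) * kap g (t, φ x)) • tau g (t, φ x)
        + (-2 * kapD g 1 (t, φ x)) • nu g (t, φ x) := by
    simp [frameField, forcePoly, evAt, ev, jetAt, kapD]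
  have hnu : ‖nu g (t, φ x)‖ ^ 2 = 1 := by
    rw [← real_inner_self_eq_norm_sq, nu, inner_rot_rot]
    exact H.inner_tau_tau (p := (t, φ x)) ht
  rw [h1, h2, h3, e1, e2, e3, e4, norm_smul, norm_smul, mul_pow, mul_pow, hnu, Real.norm_eq_abs,
    Real.norm_eq_abs, sq_abs, sq_abs]
  set ℓ := lengthAt g t
  have hc : (μ - 3 * ((ℓ ^ 2) ^ 2 * (kap g (t, φ x) ^ 2 * 1) / ℓ ^ 4)) / ℓ * ℓ ^ 1
      = μ - 3 * kap g (t, φ x) ^ 2 := by field_simp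
  have hc2 : 2 / ℓ ^ 3 * ℓ ^ 3 = 2 := by field_simp
  rw [smul_smul, smul_smul, hc, hc2]
  module

/-- The force vector varies little where the normal velocity is small. -/
lemma IsMotion.norm_force_sub_le (H : IsMotion g V W) (ht : 0 < t) (hℓ : 0 ≤ lengthAt g t)
    (hφ : ∀ x, HasDerivAt φ (lengthAt g t / speedAt g t (φ x)) x) {η : ℝ}
    (hη : ∀ x, |ev (jetAt g t) (vel μ) x| ≤ η) (x : ℝ) :
    ‖frameField g (forcePoly μ) (t, φ x) - frameField g (forcePoly μ) (t, φ 0)‖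
      ≤ lengthAt g t * η * |x| := by
  have hd := H.hasDerivAt_frameField ht hφ (forcePoly μ)
  have := Convex.norm_image_sub_le_of_norm_hasDerivWithin_le (C := lengthAt g t * η)
    (fun y (_ : y ∈ Set.univ) => (hd y).hasDerivWithinAt) (fun y _ => ?_) convex_univ
    (Set.mem_univ 0) (Set.mem_univ x)
  · simpa using this
  · rw [norm_smul, Real.norm_of_nonneg hℓ, frameD_forcePoly]
    refine mul_le_mul_of_nonneg_left ?_ hℓ
    refine (H.norm_frameField_le _ (p := (t, φ y)) ht).trans ?_
    have h0 : evAt g 0 (t, φ y) = 0 := by simp [evAt, ev]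
    rw [h0, abs_zero, zero_add]
    exact hη (φ y)

/-- Positive orders are bounded through the upper bound on the length and the bounds on curvature
polynomials. The curve itself is bounded only after subtracting its base point. -/
lemma exists_bound_iteratedDeriv_reparam (H : IsElasticMotion μ g V W) (hμ : 0 < μ) (m : ℕ) :
    ∃ B, ∀ t, 1 ≤ t → ∀ φ : ℝ → ℝ, IsReparametrization φ →
      (∀ x, HasDerivAt φ (lengthAt g t / speedAt g t (φ x)) x) →
      ∀ x, ‖iteratedDeriv m (fun x => g (t, φ x) - g (t, φ 0)) x‖ ≤ B := by
  obtain ⟨K, L, M, hK, hL, hb⟩ := H.exists_basic_bounds hμ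
  have hbound : ∀ m, ∃ B, ∀ t, 1 ≤ t → ∀ φ : ℝ → ℝ,
      (∀ x, HasDerivAt φ (lengthAt g t / speedAt g t (φ x)) x) →
      ∀ x, ‖iteratedDeriv (m + 1) (fun x => g (t, φ x) - g (t, φ 0)) x‖ ≤ B := by
    intro m
    obtain ⟨A, hA⟩ := H.exists_abs_ev_le hμ (frameD^[m] (1, 0)).1
    obtain ⟨B, hB⟩ := H.exists_abs_ev_le hμ (frameD^[m] (1, 0)).2
    refine ⟨M ^ (m + 1) * (A + B), fun t ht φ hφ x => ?_⟩
    have ht0 : 0 < t := zero_lt_one.trans_le ht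
    have hℓ : 0 ≤ lengthAt g t := hL.le.trans (hb t ht).2.1
    rw [H.iteratedDeriv_reparam ht0 hφ, norm_smul, norm_pow, Real.norm_of_nonneg hℓ]
    refine mul_le_mul (pow_le_pow_left₀ hℓ (hb t ht).2.2 _)
      ((H.norm_frameField_le _ (p := (t, φ x)) ht0).trans
        (add_le_add (hA t (φ x) ht) (hB t (φ x) ht))) (norm_nonneg _)
      (pow_nonneg (hℓ.trans (hb t ht).2.2) _)
  cases m with
  | succ m =>
    obtain ⟨B, hB⟩ := hbound m
    exact ⟨B, fun t ht φ _ hφ => hB t ht φ hφ⟩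
  | zero =>
    obtain ⟨B, hB⟩ := hbound 0
    refine ⟨B, fun t ht φ hrep hφ x => ?_⟩
    have ht0 : 0 < t := zero_lt_one.trans_le ht
    have hB' := hB t ht φ hφ
    simp only [zero_add, iteratedDeriv_one, iteratedDeriv_zero] at hB' ⊢
    set c : ℝ → Plane := fun x => g (t, φ x) - g (t, φ 0) with hc
    have hper : Function.Periodic c 1 := fun x => by
      simp only [hc, hrep.map_add_one]
      rw [H.periodic (t, φ x) ht0]
    -- By periodicity it suffices to bound `c` on one period, where it starts at `0` and has
    -- derivative at most `B`.
    obtain ⟨y, hy, hyx⟩ := exists_mem_Icc_of_periodic (f := fun x => ‖c x‖)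
      (fun x => by simp only [hper x]) x
    rw [← hyx]
    have hB0 : 0 ≤ B := (norm_nonneg _).trans (hB' 0)
    have h1 := Convex.norm_image_sub_le_of_norm_deriv_le (f := c) (s := Set.univ) (C := B)
      (fun z _ => ((H.hasDerivAt_comp_reparam ht0 hφ H.smooth z).sub_const _).differentiableAt)
      (fun z _ => hB' z) convex_univ (Set.mem_univ 0) (Set.mem_univ y)
    have h2 : c 0 = 0 := by simp [hc]
    rw [h2, sub_zero, sub_zero, Real.norm_of_nonneg hy.1] at h1
    nlinarith [hy.2]

/-- Subconvergence of the elastic flow to an elastica. -/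
lemma IsElasticMotion.subconvergence (H : IsElasticMotion μ g V W) (hμ : 0 < μ) :
    ∃ (t : ℕ → ℝ) (φ : ℕ → ℝ → ℝ) (p : ℕ → Plane) (γLim : ℝ → Plane),
      StrictMono t ∧ (∀ i, 0 < t i) ∧ Filter.Tendsto t Filter.atTop Filter.atTop ∧
      (∀ i, IsReparametrization (φ i)) ∧ IsElastica μ γLim ∧
      SmoothlyConverges (fun i x => g (t i, φ i x) - p i) γLim := by
  obtain ⟨K, L, M, hK, hL, hb⟩ := H.exists_basic_bounds hμ
  -- Times `T n ≥ n` at which the normal velocity is at most `1 / (n + 1)`.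
  choose T hT1 hTn hTV using fun n : ℕ =>
    H.exists_time_vel_le hμ (ε := 1 / ((n : ℝ) + 1)) (by positivity) n
  have hTtop : Filter.Tendsto T Filter.atTop Filter.atTop :=
    Filter.tendsto_atTop_mono hTn tendsto_natCast_atTop_atTop
  obtain ⟨σ, hσ, hTσ⟩ := Filter.strictMono_subseq_of_tendsto_atTop hTtop
  have hpos : ∀ n, 0 < T n := fun n => zero_lt_one.trans_le (hT1 n)
  have hsp : ∀ n, ContDiff ℝ ∞ (speedAt g (T n)) := fun n => contDiff_iff_contDiffAt.2 fun x =>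
    (H.smooth_speed (T n, x) (hpos n)).comp x (contDiffAt_const.prodMk contDiffAt_id)
  choose φ hrep hφ using fun n => exists_reparametrization (hsp n)
    (H.isJet (hpos n)).pos fun x => H.periodic_speed (T n, x) (hpos n)
  set c : ℕ → ℝ → Plane := fun n x => g (T n, φ n x) - g (T n, φ n 0) with hc
  have hcs : ∀ n, ContDiff ℝ ∞ (c n) := fun n => contDiff_iff_contDiffAt.2 fun x =>
    ((H.smooth (T n, φ n x) (hpos n)).comp x
      (contDiffAt_const.prodMk (hrep n).smooth.contDiffAt)).sub contDiffAt_const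
  have hcp : ∀ n, Function.Periodic (c n) 1 := fun n x => by
    simp only [hc, (hrep n).map_add_one]
    rw [H.periodic (T n, φ n x) (hpos n)]
  obtain ⟨ρ, cL, hρ, hcLs, hcLp, hconv⟩ := exists_smooth_limit (c := fun n => c (σ n))
    (fun n => hcs _) (fun n => hcp _) fun m => by
      obtain ⟨B, hB⟩ := exists_bound_iteratedDeriv_reparam H hμ m
      exact ⟨B, fun n x => hB _ (hT1 _) _ (hrep _) (hφ _) x⟩
  set θ : ℕ → ℕ := fun n => σ (ρ n) with hθ
  have hθm : StrictMono θ := hσ.comp hρ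
  refine ⟨fun n => T (θ n), fun n => φ (θ n), fun n => g (T (θ n), φ (θ n) 0), cL,
    hTσ.comp hρ, fun n => hpos _, hTtop.comp hθm.tendsto_atTop, fun n => hrep _, ?_, hconv⟩
  have hpt : ∀ m x, Filter.Tendsto (fun n => iteratedDeriv m (c (θ n)) x) Filter.atTop
      (nhds (iteratedDeriv m cL x)) := fun m x => (hconv m).tendsto_at x
  have hspeed : ∀ n x, ‖iteratedDeriv 1 (c n) x‖ = lengthAt g (T n) := fun n x => by
    have h1 := congrFun (H.iteratedDeriv_reparam (hpos n) (hφ n) (g (T n, φ n 0)) 0) x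
    have h2 : ‖tau g (T n, φ n x)‖ = 1 := by
      have := H.inner_tau_tau (p := (T n, φ n x)) (hpos n)
      rw [real_inner_self_eq_norm_sq] at this
      exact (pow_eq_one_iff_of_nonneg (norm_nonneg _) two_ne_zero).1 this
    have hℓ : 0 ≤ lengthAt g (T n) := hL.le.trans (hb _ (hT1 n)).2.1
    have h3 : frameField g (frameD^[0] (1, 0)) (T n, φ n x) = tau g (T n, φ n x) := by
      simp [frameField, evAt, ev]
    rw [h3, zero_add, pow_one] at h1
    rw [hc, h1, norm_smul, h2, mul_one, Real.norm_of_nonneg hℓ]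
  -- The constant speed equals the length, so the lengths converge to the speed of the limit, which
  -- is therefore constant and at least `L > 0`.
  have hlen : ∀ x, Filter.Tendsto (fun n => lengthAt g (T (θ n))) Filter.atTop
      (nhds ‖iteratedDeriv 1 cL x‖) := fun x => by
    have := (hpt 1 x).norm
    simpa only [hspeed] using this
  set ℓ := ‖iteratedDeriv 1 cL 0‖ with hℓ
  have hℓx : ∀ x, ‖iteratedDeriv 1 cL x‖ = ℓ := fun x => tendsto_nhds_unique (hlen x) (hlen 0)
  have hℓ0 : 0 < ℓ := hL.trans_le (ge_of_tendsto' (hlen 0) fun n => (hb _ (hT1 _)).2.1)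
  have hforce : ∀ x, Filter.Tendsto
      (fun n => frameField g (forcePoly μ) (T (θ n), φ (θ n) x)) Filter.atTop
      (nhds (((μ - 3 * (‖iteratedDeriv 2 cL x‖ ^ 2 / ℓ ^ 4)) / ℓ) • iteratedDeriv 1 cL x
        - (2 / ℓ ^ 3) • iteratedDeriv 3 cL x)) := fun x => by
    have h1 : ∀ n, frameField g (forcePoly μ) (T (θ n), φ (θ n) x) = _ := fun n =>
      (H.force_eq (μ := μ) (hpos (θ n)) (hL.trans_le (hb _ (hT1 _)).2.1) (hφ (θ n))
        (g (T (θ n), φ (θ n) 0)) x).symm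
    simp only [h1]
    have hl := hlen 0
    refine (((tendsto_const_nhds.sub (((((hpt 2 x).norm.pow 2).div (hl.pow 4)
      (by positivity))).const_mul 3)).div hl hℓ0.ne').smul (hpt 1 x)).sub
      ((tendsto_const_nhds.div (hl.pow 3) (by positivity)).smul (hpt 3 x))
  refine isElastica_of_const hcLs hcLp hℓ0 (fun x => by rw [← iteratedDeriv_one]; exact hℓx x)
    (J := ((μ - 3 * (‖iteratedDeriv 2 cL 0‖ ^ 2 / ℓ ^ 4)) / ℓ) • iteratedDeriv 1 cL 0
        - (2 / ℓ ^ 3) • iteratedDeriv 3 cL 0) fun x => ?_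
  have hdiff := (hforce x).sub (hforce 0)
  -- The oscillation of the force vector is at most length times the supremum of `|V|` times `|x|`,
  -- and the velocity bound `1 / (θ n + 1)` tends to zero.
  have hzero : Filter.Tendsto (fun n => frameField g (forcePoly μ) (T (θ n), φ (θ n) x)
      - frameField g (forcePoly μ) (T (θ n), φ (θ n) 0)) Filter.atTop (nhds 0) := by
    refine squeeze_zero_norm (a := fun n => M * (1 / ((θ n : ℝ) + 1)) * |x|) (fun n => ?_) ?_
    · have hℓn : 0 ≤ lengthAt g (T (θ n)) := hL.le.trans (hb _ (hT1 _)).2.1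
      refine (H.norm_force_sub_le (hpos (θ n)) hℓn (hφ (θ n)) (hTV (θ n)) x).trans ?_
      gcongr
      exact (hb _ (hT1 _)).2.2
    · have h1 := (tendsto_one_div_add_atTop_nhds_zero_nat (𝕜 := ℝ)).comp hθm.tendsto_atTop
      simpa using (h1.const_mul M).mul_const |x|
  exact sub_eq_zero.1 (tendsto_nhds_unique hdiff hzero)

end Convergence

end ElasticFlow
end

theorem mainTheorem6 (μ : ℝ) (hμ : 0 < μ) (α : ℝ) (hα₀ : 0 < α) (hα₁ : α < 1)
    (γ₀ : ℝ → ElasticFlow.Plane) (γ : ℝ → ℝ → ElasticFlow.Plane)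
    (hγ : ElasticFlow.IsGlobalSolution μ α γ₀ γ) :
    ∃ (t : ℕ → ℝ) (φ : ℕ → ℝ → ℝ) (p : ℕ → ElasticFlow.Plane) (γLim : ℝ → ElasticFlow.Plane),
      StrictMono t ∧ (∀ i, 0 < t i) ∧ Filter.Tendsto t Filter.atTop Filter.atTop ∧
      (∀ i, ElasticFlow.IsReparametrization (φ i)) ∧
      ElasticFlow.IsElastica μ γLim ∧
      ElasticFlow.SmoothlyConverges (fun i x => γ (t i) (φ i x) - p i) γLim :=
  hγ.isElasticMotion.subconvergence hμ
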